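/- For a permutation $w\in S_n$, let $\Upsilon_w=\mathfrak S_w(1^n)$ be the principal specialization of its Schubert polynomial, i.e. the number of reduced pipe dreams of size $n$ with boundary permutation $w$. (A pipe dream of size $n$ is a filling of the staircase of tiles $(i,j)$, $i,j\ge 1$, $i+j\le n$, by crossings and elbows, with elbows on the antidiagonal $i+j=n+1$; it is reduced if each pair of pipes crosses at most once; its boundary permutation is $w$ if, for each $i$, the pipe entering row $i$ from the left exits at the top of column $w(i)$.) For a composition $(b_1,\dots,b_k)$ of $n$, the layered permutation $w(b_1,\dots,b_k)\in S_n$ is obtained by splitting $1,\dots,n$ into consecutive blocks of sizes $b_1,\dots,b_k$ and reversing each block. **Theorem.** The Merzon–Smirnov conjecture, which asserts that for every $n$ the maximum of $\Upsilon_w$ over $w\in S_n$ is attained at a layered permutation, is false. More precisely, among all layered permutations in $S_{17}$ the maximum of $\Upsilon$ is attained at $w(1,2,4,10)$, and $$\Upsilon_{w(1,2,4,10)}=3{,}050{,}684{,}475{,}186{,}219{,}300{,}000 .$$ The permutation $$w^*=(1,3,2,7,6,5,17,4,16,15,14,13,12,11,10,9,8)=w(1,2,4,10)\cdot s_7\in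 S_{17}$$ is not layered, and $$\Upsilon_{w^*}=3{,}272{,}424{,}600{,}397{,}137{,}120{,}000,$$ which exceeds the layered maximum by about $7\%$ (between $7\%$ and $8\%$). The permutation $$u^*=(1,3,2,8,6,5,17,4,16,15,14,13,12,11,10,9,7)=w(1,2,4,10)\cdot s_7\cdot(4\ 17)\in S_{17}$$ is not layered either, and $$\Upsilon_{u^*}=3{,}528{,}445{,}515{,}842{,}977{,}489{,}500,$$ which exceeds the layered maximum by about $15.6\%$ (between $15.6\%$ and $15.7\%$). Here $s_7=(7\ 8)$, and right multiplication by a transposition exchanges the entries in the corresponding positions of the one-line notation. -/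

import Mathlib

/-!
Rows and columns are numbered from `0`.  Row `0` is the top row, column `0` the leftmost column.
-/

namespace Schubert

/-! ### Reduced pipe dreams -/

/-- The tiles of the staircase of size `n` in which a crossing may be placed
(in `1`-based coordinates: the tiles `(i, j)` with `i + j ≤ n`). -/
def staircase (n : ℕ) : Finset (ℕ × ℕ) :=
  (Finset.range n ×ˢ Finset.range n).filter fun c => c.1 + c.2 + 1 < n

/-- The label of the pipe on the left edge of tile `(i, j)`, given the labels `b j` of the pipes on
the bottom edges of the tiles `(i, j)` of row `i`; `D` is the set of crossing tiles.
The pipe entering row `i` from the left border is labelled `i`.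
A crossing joins left to right, an elbow joins bottom to right. -/
def leftLabel (D : Finset (ℕ × ℕ)) (i : ℕ) (b : ℕ → ℕ) : ℕ → ℕ
  | 0 => i
  | j + 1 => if (i, j) ∈ D then leftLabel D i b j else b j

/-- The label of the pipe on the top edge of tile `(i, j)`, where `D` is the set of crossing tiles.
A crossing joins bottom to top, an elbow joins left to top.
All tiles `(i, j)` with `i + j + 1 ≥ n`, in particular those of the rows `i ≥ n`, are elbows;
so the pipe leaving `(i, j)` through the top is pipe `i + j` when `i ≥ n`. -/
def topLabel (n : ℕ) (D : Finset (ℕ × ℕ)) (i : ℕ) : ℕ → ℕ :=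
  if i < n then
    fun j =>
      if (i, j) ∈ D then topLabel n D (i + 1) j
      else leftLabel D i (topLabel n D (i + 1)) j
  else fun j => i + j
termination_by n - i

/-- The unordered pair of the pipes that enter tile `c`, from the left and from below. -/
def pipesAt (n : ℕ) (D : Finset (ℕ × ℕ)) (c : ℕ × ℕ) : Sym2 ℕ :=
  s(leftLabel D c.1 (topLabel n D (c.1 + 1)) c.2, topLabel n D (c.1 + 1) c.2)

/-- Each pair of pipes crosses at most once. -/
def IsReduced (n : ℕ) (D : Finset (ℕ × ℕ)) : Prop :=
  ∀ c ∈ D, ∀ c' ∈ D, pipesAt n D c = pipesAt n D c' → c = c'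

/-- The pipe entering row `i` from the left exits at the top of column `w i`, for every `i`. -/
def HasBoundary {n : ℕ} (D : Finset (ℕ × ℕ)) (w : Equiv.Perm (Fin n)) : Prop :=
  ∀ i : Fin n, topLabel n D 0 (w i) = i

open Classical in
/-- The reduced pipe dreams of size `n` with boundary permutation `w`, a pipe dream being given by
its set of crossing tiles (all other tiles are elbows). -/
noncomputable def reducedPipeDreams {n : ℕ} (w : Equiv.Perm (Fin n)) :
    Finset (Finset (ℕ × ℕ)) :=
  (staircase n).powerset.filter fun D => IsReduced n D ∧ HasBoundary D w

/-- The Schubert polynomial of `w`: a pipe dream contributes the product of the variables attached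
to the rows of its crossings. -/
noncomputable def schubert {n : ℕ} (w : Equiv.Perm (Fin n)) : MvPolynomial ℕ ℤ :=
  ∑ D ∈ reducedPipeDreams w, ∏ c ∈ D, MvPolynomial.X c.1

/-- The principal specialization `Υ_w`: the number of reduced pipe dreams with boundary
permutation `w`. -/
noncomputable def Upsilon {n : ℕ} (w : Equiv.Perm (Fin n)) : ℕ :=
  (reducedPipeDreams w).card

/-- `Υ_w` is the value of the Schubert polynomial of `w` with all variables set to `1`. -/
theorem eval_schubert {n : ℕ} (w : Equiv.Perm (Fin n)) :
    MvPolynomial.eval (fun _ => 1) (schubert w) = (Upsilon w : ℤ) := by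
  simp [schubert, Upsilon]

/-! ### Layered permutations -/

/-- The layered permutation `w(b₁, …, b_k)` of a composition of `n`: split `1, …, n` into
consecutive blocks of sizes `b₁, …, b_k` and reverse each block. -/
def layered {n : ℕ} (b : Composition n) : Equiv.Perm (Fin n) :=
  b.blocksFinEquiv.permCongr (Equiv.sigmaCongrRight fun _ => Fin.revPerm)

/-- A permutation is layered if it is `w(b₁, …, b_k)` for some composition of `n`. -/
def IsLayered {n : ℕ} (w : Equiv.Perm (Fin n)) : Prop :=
  ∃ b : Composition n, w = layered b

/-- The Merzon–Smirnov conjecture: for every `n`, the maximum of `Υ` over the symmetric group `S_n`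
is attained at a layered permutation. -/
def MerzonSmirnovConjecture : Prop :=
  ∀ n : ℕ, ∃ w : Equiv.Perm (Fin n), IsLayered w ∧ ∀ u : Equiv.Perm (Fin n), Upsilon u ≤ Upsilon w

/-! ### The permutations in question -/

/-- The composition `(1, 2, 4, 10)` of `17`. -/
def comp17 : Composition 17 where
  blocks := [1, 2, 4, 10]
  blocks_pos := by simp
  blocks_sum := by simp

/-- The layered permutation `w(1, 2, 4, 10)`. -/
def wLayered : Equiv.Perm (Fin 17) := layered comp17

/-- The permutation `w* = (1,3,2,7,6,5,17,4,16,15,14,13,12,11,10,9,8)`, with entries lowered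
by `1`. -/
def wStar : Equiv.Perm (Fin 17) where
  toFun := ![0, 2, 1, 6, 5, 4, 16, 3, 15, 14, 13, 12, 11, 10, 9, 8, 7]
  invFun := ![0, 2, 1, 7, 5, 4, 3, 16, 15, 14, 13, 12, 11, 10, 9, 8, 6]
  left_inv := by decide
  right_inv := by decide

/-- The permutation `u* = (1,3,2,8,6,5,17,4,16,15,14,13,12,11,10,9,7)`, with entries lowered
by `1`. -/
def uStar : Equiv.Perm (Fin 17) where
  toFun := ![0, 2, 1, 7, 5, 4, 16, 3, 15, 14, 13, 12, 11, 10, 9, 8, 6]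
  invFun := ![0, 2, 1, 7, 5, 4, 16, 3, 15, 14, 13, 12, 11, 10, 9, 8, 6]
  left_inv := by decide
  right_inv := by decide

/-- One-line notation of `w*`. -/
theorem wStar_oneLine : List.ofFn (fun i => (wStar i : ℕ) + 1) =
    [1, 3, 2, 7, 6, 5, 17, 4, 16, 15, 14, 13, 12, 11, 10, 9, 8] := by
  decide

/-- One-line notation of `u*`. -/
theorem uStar_oneLine : List.ofFn (fun i => (uStar i : ℕ) + 1) =
    [1, 3, 2, 8, 6, 5, 17, 4, 16, 15, 14, 13, 12, 11, 10, 9, 7] := by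
  decide

end Schubert

/-!
The proof evaluates principal specializations exactly, by rewriting them as values at `x = 1` of
Schubert polynomials for which enough algebra is available.

**From pipe dreams to the nilCoxeter algebra.** Reading the tiles of the staircase column by column,
each column from bottom to top, a crossing at `(i, j)` exchanges the pipes at the positions `i + j`
and `i + j + 1` of the current cut. Two pipes cross at most once exactly when every crossing
exchanges pipes in increasing order (`mem_crossings_iff`, `nodup_crossings_iff`). So the reduced
pipe dreams are the subwords of a fixed word which multiply to a nonzero element of the nilCoxeter
algebra, and `Υ_w` is a coefficient of the product of the factors `1 + uᵢ`: it is the value at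
`x = 1` of `schubertValue` at the inverse permutation (`upsilon_eq_schubertValue`).

**Algebra of `schubertValue`.** The Yang–Baxter equation makes the ladders of factors with the same
letters commute (`ladder_comm`). This gives the action of divided differences
(`schubertValue_divided_difference`), from which everything else follows:

* direct sums of permutations yield products (`schubertValue_glue`);
* the longest permutation yields a monomial, which is also a flagged Jacobi–Trudi determinant
  (`schubertValue_reversal`, `det_flagMatrix_staircase`). A divided difference carries a flagged
  determinant to a flagged determinant whenever a single row has the flag concerned
  (`det_flagMatrix_divided_difference`), and flags can be raised or lowered to reach this situation
  (`det_flagMatrix_raise`). A word for `w` thus leads to a determinant for `w`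
  (`schubertValue_eq_flagPoly_run`), whose entries at `x = 1` are binomial coefficients;
* Monk's rule holds (`mul_schubertValue`): the difference of its two sides is invariant under all
  simple transpositions by induction on the permutation, hence constant, hence zero.

**Layered permutations.** The principal specialization of a layered permutation is the product,
over its blocks, of those of the permutations with `m` fixed points followed by a reversed block of
size `b`. These are all computed as determinants, and the maximum over the compositions of `17` is
bounded by descending induction on `m` (`layeredMax`, `checkBlock_eq_true`).

**The counterexamples.** Both `(w*)⁻¹` and `(u*)⁻¹ = u*` are direct sums of `132` and of a
permutation to which Monk's rule at `x = 1` is applied recursively (`monkEval`). It sorts the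
entries up to `7`, up to one of them in the last place, and ends at permutations that have flagged
determinants (`leafTable`). The comparison of the values shows that neither permutation is layered.
-/

namespace Schubert

/-! ### The Yang–Baxter equation in a nilCoxeter algebra -/

section NilCoxeter

variable {R E : Type*} [CommRing R] [Ring E] [Algebra R E]

/-- Elements `u 0, u 1, …` satisfying the relations of the nilCoxeter algebra. -/
structure IsNilCoxeter (u : ℕ → E) : Prop where
  sq : ∀ i, u i * u i = 0
  braid : ∀ i, u i * u (i + 1) * u i = u (i + 1) * u i * u (i + 1)
  comm : ∀ i j, i + 2 ≤ j → u i * u j = u j * u i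

/-- The factor `1 + x uᵢ` contributed by a tile of weight `x` on the antidiagonal `i`. -/
def factor (u : ℕ → E) (i : ℕ) (x : R) : E := 1 + x • u i

/-- The product `(1 + x uᵢ) (1 + x uᵢ₊₁) ⋯ (1 + x uᵢ₊ₖ₋₁)`. -/
def ladder (u : ℕ → E) : ℕ → ℕ → R → E
  | _, 0, _ => 1
  | i, k + 1, x => factor u i x * ladder u (i + 1) k x

/-- The product of ladders, for the letters `i, …, i + k - 1` and the variables
`x i, x (i + 1), …`, whose coefficients are Schubert polynomials. -/
def ladders (u : ℕ → E) : ℕ → ℕ → (ℕ → R) → E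
  | _, 0, _ => 1
  | i, k + 1, x => ladders u (i + 1) k x * ladder u i (k + 1) (x i)

variable {u : ℕ → E}

theorem ladder_succ (u : ℕ → E) (i k : ℕ) (x : R) :
    ladder u i (k + 1) x = factor u i x * ladder u (i + 1) k x := rfl

theorem factor_mul_factor (hu : IsNilCoxeter u) (i : ℕ) (x y : R) :
    factor u i x * factor u i y = factor u i (x + y) := by
  simp only [factor, mul_add, add_mul, one_mul, mul_one, smul_mul_assoc, mul_smul_comm, hu.sq,
    smul_zero]
  module

theorem factor_comm (hu : IsNilCoxeter u) {i j : ℕ} (hij : i + 2 ≤ j) (x y : R) :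
    factor u i x * factor u j y = factor u j y * factor u i x := by
  simp only [factor, mul_add, add_mul, one_mul, mul_one, smul_mul_assoc, mul_smul_comm,
    hu.comm i j hij]
  module

theorem yangBaxter (hu : IsNilCoxeter u) (i : ℕ) (x y : R) :
    factor u i x * factor u (i + 1) (x + y) * factor u i y =
      factor u (i + 1) y * factor u i (x + y) * factor u (i + 1) x := by
  simp only [factor, mul_add, add_mul, one_mul, mul_one, smul_mul_assoc, mul_smul_comm, hu.sq i,
    hu.sq (i + 1), hu.braid i, smul_zero]
  module

theorem factor_ladder_comm (hu : IsNilCoxeter u) {i j : ℕ} (hij : i + 2 ≤ j) (k : ℕ) (x y : R) :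
    factor u i x * ladder u j k y = ladder u j k y * factor u i x := by
  induction k generalizing j with
  | zero => simp [ladder]
  | succ k ih =>
    rw [ladder, ← mul_assoc, factor_comm hu hij, mul_assoc, ih (by omega), mul_assoc]

theorem u_ladder_comm (hu : IsNilCoxeter u) {i j : ℕ} (hij : i + 2 ≤ j) (k : ℕ) (y : R) :
    u i * ladder u j k y = ladder u j k y * u i := by
  have h := factor_ladder_comm hu hij k (1 : R) y
  simpa [factor, add_mul, mul_add] using h

theorem u_ladders_comm (hu : IsNilCoxeter u) {i j : ℕ} (hij : i + 2 ≤ j) (k : ℕ) (x : ℕ → R) :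
    u i * ladders u j k x = ladders u j k x * u i := by
  induction k generalizing j with
  | zero => simp [ladders]
  | succ k ih =>
    rw [ladders, ← mul_assoc, ih (by omega), mul_assoc, u_ladder_comm hu hij, mul_assoc]

/-- Ladders on the same letters commute; this is the consequence of the Yang–Baxter equation
that makes the coefficients symmetric. -/
theorem ladder_comm (hu : IsNilCoxeter u) (i k : ℕ) (x y : R) :
    ladder u i k x * ladder u i k y = ladder u i k y * ladder u i k x := by
  induction k generalizing i x y with
  | zero => simp [ladder]
  | succ k ih =>
    cases k with
    | zero => simp [ladder, factor_mul_factor hu, add_comm]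
    | succ k =>
      -- `S z w` is symmetric in its arguments, and each side is a word in four factors times it
      set S : R → R → E := fun z w => ladder u (i + 1) (k + 1) z * ladder u (i + 1) (k + 1) w
      have hS : ∀ z w, S z w = S w z := fun z w => ih (i + 1) z w
      have h0 : ∀ z : R, factor u (i + 1) (-z) * ladder u (i + 1) (k + 1) z =
          ladder u (i + 2) k z := fun z => by
        rw [ladder, ← mul_assoc, factor_mul_factor hu, neg_add_cancel]
        simp [factor]
      have h1 : ∀ z w : R, ladder u i (k + 2) z * ladder u i (k + 2) w =
          factor u i z * factor u (i + 1) z * factor u i w * factor u (i + 1) (-z) * S z w := by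
        intro z w
        have : S z w = ladder u (i + 1) (k + 1) z * ladder u (i + 1) (k + 1) w := rfl
        rw [this, mul_assoc _ (factor u (i + 1) (-z)), ← mul_assoc (factor u (i + 1) (-z)), h0,
          ladder_succ u i (k + 1) z, ladder_succ u (i + 1) k z, ladder_succ u i (k + 1) w]
        have := factor_ladder_comm hu (show i + 2 ≤ i + 1 + 1 by omega) k w z
        simp only [mul_assoc]
        rw [← mul_assoc (ladder u (i + 1 + 1) k z), ← this]
        simp only [mul_assoc]
      have h2 : ∀ z w : R, factor u i z * factor u (i + 1) z * factor u i w =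
          factor u i w * factor u (i + 1) w * factor u i z * factor u (i + 1) (z - w) := by
        intro z w
        have := yangBaxter hu i (z - w) w
        rw [sub_add_cancel] at this
        rw [mul_assoc (factor u i w * factor u (i + 1) w), mul_assoc (factor u i w), ← mul_assoc
          (factor u (i + 1) w), ← this, ← mul_assoc, ← mul_assoc, factor_mul_factor hu]
        simp
      rw [h1, h1, h2 x y, mul_assoc _ (factor u (i + 1) (x - y)), factor_mul_factor hu, hS x y,
        show x - y + -x = -y by ring]

/-- The divided difference of a product of two consecutive ladders. -/
theorem ladder_divided_difference (hu : IsNilCoxeter u) (i k : ℕ) (x y : R) :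
    (x - y) • (u i * (ladder u (i + 1) (k + 1) y * ladder u i (k + 2) x)) =
      ladder u (i + 1) (k + 1) y * ladder u i (k + 2) x -
        ladder u (i + 1) (k + 1) x * ladder u i (k + 2) y := by
  have h0 : ∀ z : R, ladder u (i + 1) (k + 1) z = factor u i (-z) * ladder u i (k + 2) z :=
    fun z => by
      rw [ladder_succ u i, ← mul_assoc, factor_mul_factor hu, neg_add_cancel]
      simp [factor]
  rw [h0, h0, mul_assoc, mul_assoc, ladder_comm hu i (k + 2) y x]
  simp only [factor, add_mul, mul_add, one_mul, smul_mul_assoc, mul_smul_comm, ← mul_assoc,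
    hu.sq, zero_mul, smul_zero]
  module

theorem ladders_congr {x y : ℕ → R} (i k : ℕ) (h : ∀ j, i ≤ j → j < i + k → x j = y j) :
    ladders u i k x = ladders u i k y := by
  induction k generalizing i with
  | zero => rfl
  | succ k ih =>
    rw [ladders, ladders, h i le_rfl (by omega),
      ih (i + 1) fun j h1 h2 => h j (by omega) (by omega)]

/-- Divided differences of the product of all ladders amount to multiplication by a generator. -/
theorem ladders_divided_difference (hu : IsNilCoxeter u) (j k i : ℕ) (hj : j ≤ i)
    (hi : i < j + k) (x : ℕ → R) :
    (x i - x (i + 1)) • (u i * ladders u j k x) =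
      ladders u j k x - ladders u j k (x ∘ Equiv.swap i (i + 1)) := by
  induction k generalizing j with
  | zero => omega
  | succ k ih =>
    rcases hj.lt_or_eq with hj | rfl
    · have hx : (x ∘ Equiv.swap i (i + 1)) j = x j := by
        simp [Equiv.swap_apply_of_ne_of_ne (show j ≠ i by omega) (show j ≠ i + 1 by omega)]
      rw [ladders, ladders, hx, ← sub_mul, ← ih (j + 1) hj (by omega), smul_mul_assoc, mul_assoc]
    · cases k with
      | zero =>
        simp only [ladders, ladder, factor, Function.comp, Equiv.swap_apply_left, mul_one, one_mul,
          mul_add, mul_smul_comm, hu.sq, smul_zero]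
        module
      | succ k =>
        have hc : ladders u (j + 1 + 1) k (x ∘ Equiv.swap j (j + 1)) =
            ladders u (j + 1 + 1) k x := ladders_congr _ _ fun l h1 h2 => by
          simp [Equiv.swap_apply_of_ne_of_ne (show l ≠ j by omega) (show l ≠ j + 1 by omega)]
        simp only [ladders, hc, Function.comp, Equiv.swap_apply_left, Equiv.swap_apply_right]
        rw [mul_assoc, mul_assoc, ← mul_sub, ← ladder_divided_difference hu, ← mul_assoc (u j),
          u_ladders_comm hu (by omega), mul_assoc, mul_smul_comm]

end NilCoxeter

/-! ### Schubert polynomials as coefficients of a product in the nilCoxeter algebra -/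

section Values

variable {R S : Type*} [CommRing R] [CommRing S]

/-- Right multiplication by the `k`-th generator of the nilCoxeter algebra, on coefficient
functions. Permutations are given as functions `ℕ → ℕ`. -/
def nilGen (R : Type*) [CommRing R] (k : ℕ) : Module.End R ((ℕ → ℕ) → R) where
  toFun f w := if w (k + 1) < w k then f (w ∘ Equiv.swap k (k + 1)) else 0
  map_add' f g := by ext w; by_cases h : w (k + 1) < w k <;> simp [h]
  map_smul' c f := by ext w; by_cases h : w (k + 1) < w k <;> simp [h]

theorem nilGen_apply (k : ℕ) (f : (ℕ → ℕ) → R) (w : ℕ → ℕ) :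
    nilGen R k f w = if w (k + 1) < w k then f (w ∘ Equiv.swap k (k + 1)) else 0 := rfl

theorem factor_nilGen_apply (k : ℕ) (x : R) (f : (ℕ → ℕ) → R) (w : ℕ → ℕ) :
    factor (nilGen R) k x f w =
      f w + x * if w (k + 1) < w k then f (w ∘ Equiv.swap k (k + 1)) else 0 := by
  simp [factor, nilGen_apply]

theorem swap_comp_swap_braid (k : ℕ) (w : ℕ → ℕ) :
    ((w ∘ Equiv.swap k (k + 1)) ∘ Equiv.swap (k + 1) (k + 1 + 1)) ∘ Equiv.swap k (k + 1) =
      ((w ∘ Equiv.swap (k + 1) (k + 1 + 1)) ∘ Equiv.swap k (k + 1)) ∘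
        Equiv.swap (k + 1) (k + 1 + 1) := by
  ext i
  simp only [Function.comp, Equiv.swap_apply_def]
  congr 1
  split_ifs <;> omega

theorem isNilCoxeter_nilGen : IsNilCoxeter (nilGen R) where
  sq i := by
    ext f w
    simp only [Module.End.mul_apply, nilGen_apply, Function.comp, Equiv.swap_apply_left,
      Equiv.swap_apply_right, LinearMap.zero_apply, Pi.zero_apply]
    split_ifs <;> first | omega | rfl
  braid i := by
    ext f w
    have e1 : Equiv.swap i (i + 1) (i + 1 + 1) = i + 1 + 1 :=
      Equiv.swap_apply_of_ne_of_ne (by omega) (by omega)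
    have e2 : Equiv.swap (i + 1) (i + 1 + 1) i = i :=
      Equiv.swap_apply_of_ne_of_ne (by omega) (by omega)
    have e3 := swap_comp_swap_braid i w
    simp only [Module.End.mul_apply, nilGen_apply, e3]
    simp only [Function.comp, Equiv.swap_apply_left, Equiv.swap_apply_right, e1, e2]
    split_ifs <;> rfl
  comm i j hij := by
    ext f w
    have e1 : Equiv.swap i (i + 1) j = j := Equiv.swap_apply_of_ne_of_ne (by omega) (by omega)
    have e2 : Equiv.swap i (i + 1) (j + 1) = j + 1 :=
      Equiv.swap_apply_of_ne_of_ne (by omega) (by omega)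
    have e3 : Equiv.swap j (j + 1) i = i := Equiv.swap_apply_of_ne_of_ne (by omega) (by omega)
    have e4 : Equiv.swap j (j + 1) (i + 1) = i + 1 :=
      Equiv.swap_apply_of_ne_of_ne (by omega) (by omega)
    have e5 : (w ∘ Equiv.swap i (i + 1)) ∘ Equiv.swap j (j + 1) =
        (w ∘ Equiv.swap j (j + 1)) ∘ Equiv.swap i (i + 1) := by
      ext l
      simp only [Function.comp, Equiv.swap_apply_def]
      congr 1
      split_ifs <;> omega
    simp only [Module.End.mul_apply, nilGen_apply, e5]
    simp only [Function.comp, e1, e2, e3, e4]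
    split_ifs <;> rfl

open Classical in
/-- The coefficient function of the unit of the nilCoxeter algebra. -/
noncomputable def nilOne (R : Type*) [CommRing R] (w : ℕ → ℕ) : R := if w = id then 1 else 0

/-- The value of the Schubert polynomial of `w` at `x`, for permutations `w` of
`0, …, n - 1` (extended to `ℕ` by fixed points). -/
noncomputable def schubertValue (n : ℕ) (x : ℕ → R) (w : ℕ → ℕ) : R :=
  ladders (nilGen R) 0 (n - 1) x (nilOne R) w

theorem schubertValue_divided_difference {n i : ℕ} (hi : i + 1 < n) (x : ℕ → R) (w : ℕ → ℕ) :
    (x i - x (i + 1)) *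
        (if w (i + 1) < w i then schubertValue n x (w ∘ Equiv.swap i (i + 1)) else 0) =
      schubertValue n x w - schubertValue n (x ∘ Equiv.swap i (i + 1)) w := by
  have h := ladders_divided_difference (isNilCoxeter_nilGen (R := R)) 0 (n - 1) i (by omega)
    (by omega) x
  have h' := congrFun (congrArg (fun φ : Module.End R ((ℕ → ℕ) → R) => φ (nilOne R)) h) w
  simpa [nilGen_apply, schubertValue] using h'

theorem schubertValue_congr {n : ℕ} {x y : ℕ → R} (h : ∀ j, j + 1 < n → x j = y j)
    (w : ℕ → ℕ) : schubertValue n x w = schubertValue n y w := by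
  rw [schubertValue, schubertValue, ladders_congr _ _ fun j _ hj => h j (by omega)]

theorem ladder_nilGen_map (φ : R →+* S) (i k : ℕ) (x : R) (f : (ℕ → ℕ) → R) (w : ℕ → ℕ) :
    φ (ladder (nilGen R) i k x f w) =
      ladder (nilGen S) i k (φ x) (fun v => φ (f v)) w := by
  induction k generalizing i w with
  | zero => rfl
  | succ k ih =>
    simp only [ladder, Module.End.mul_apply, factor_nilGen_apply, map_add, map_mul, ih]
    split_ifs <;> simp [ih]

theorem ladders_nilGen_map (φ : R →+* S) (i k : ℕ) (x : ℕ → R) (f : (ℕ → ℕ) → R)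
    (w : ℕ → ℕ) :
    φ (ladders (nilGen R) i k x f w) =
      ladders (nilGen S) i k (φ ∘ x) (fun v => φ (f v)) w := by
  induction k generalizing i f w with
  | zero => rfl
  | succ k ih =>
    simp only [ladders, Module.End.mul_apply, ih, ladder_nilGen_map, Function.comp]

theorem schubertValue_map (φ : R →+* S) (n : ℕ) (x : ℕ → R) (w : ℕ → ℕ) :
    φ (schubertValue n x w) = schubertValue n (φ ∘ x) w := by
  have h : (fun v => φ (nilOne R v)) = nilOne S := by
    funext v
    simp only [nilOne]
    split_ifs <;> simp
  rw [schubertValue, ladders_nilGen_map, schubertValue, h]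

theorem ladder_nilGen_id (i k : ℕ) (x : R) (f : (ℕ → ℕ) → R) :
    ladder (nilGen R) i k x f id = f id := by
  induction k generalizing i with
  | zero => rfl
  | succ k ih => simp [ladder, Module.End.mul_apply, factor_nilGen_apply, ih]

theorem ladders_nilGen_id (i k : ℕ) (x : ℕ → R) (f : (ℕ → ℕ) → R) :
    ladders (nilGen R) i k x f id = f id := by
  induction k generalizing i f with
  | zero => rfl
  | succ k ih => simp [ladders, Module.End.mul_apply, ih, ladder_nilGen_id]

theorem schubertValue_id (n : ℕ) (x : ℕ → R) : schubertValue n x id = 1 := by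
  simp [schubertValue, ladders_nilGen_id, nilOne]

theorem schubertValue_zero (n : ℕ) (w : ℕ → ℕ) :
    schubertValue n (0 : ℕ → R) w = nilOne R w := by
  have h1 : ∀ i k, ladder (nilGen R) i k (0 : R) = 1 := by
    intro i k
    induction k generalizing i with
    | zero => rfl
    | succ k ih => simp [ladder, ih, factor]
  have h2 : ∀ i k, ladders (nilGen R) i k (0 : ℕ → R) = 1 := by
    intro i k
    induction k generalizing i with
    | zero => rfl
    | succ k ih => simp [ladders, ih, h1]
  simp [schubertValue, h2]

/-! ### Direct sums of permutations -/

/-- The function which is `u` below `m` and `v` from `m` on. -/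
def glue (m : ℕ) (u v : ℕ → ℕ) : ℕ → ℕ := fun i => if i < m then u i else v i

theorem glue_comp_swap_left {m k : ℕ} (hk : k + 1 < m) (u v : ℕ → ℕ) :
    glue m u v ∘ Equiv.swap k (k + 1) = glue m (u ∘ Equiv.swap k (k + 1)) v := by
  ext i
  simp only [glue, Function.comp, Equiv.swap_apply_def]
  split_ifs <;> first | rfl | omega

theorem glue_comp_swap_right {m k : ℕ} (hk : m ≤ k) (u v : ℕ → ℕ) :
    glue m u v ∘ Equiv.swap k (k + 1) = glue m u (v ∘ Equiv.swap k (k + 1)) := by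
  ext i
  simp only [glue, Function.comp, Equiv.swap_apply_def]
  split_ifs <;> first | rfl | omega

/-- On direct sums of permutations of `0, …, m - 1` and of `m, m + 1, …`, the function `f` is the
product of `a` and of a function of the second summand. -/
def FactorsThrough (m : ℕ) (f a : (ℕ → ℕ) → R) : Prop :=
  ∃ b : (ℕ → ℕ) → R, ∀ u v : ℕ → ℕ, (∀ i, i < m → u i < m) → (∀ i, m ≤ i → m ≤ v i) →
    f (glue m u v) = a (glue m u id) * b v

theorem FactorsThrough.factor_left {m k : ℕ} (hk : k + 1 < m) (x : R) {f a : (ℕ → ℕ) → R}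
    (h : FactorsThrough m f a) :
    FactorsThrough m (factor (nilGen R) k x f) (factor (nilGen R) k x a) := by
  obtain ⟨b, hb⟩ := h
  refine ⟨b, fun u v hu hv => ?_⟩
  have hu' : ∀ i, i < m → (u ∘ Equiv.swap k (k + 1)) i < m := fun i hi => by
    refine hu _ ?_
    rw [Equiv.swap_apply_def]
    split_ifs <;> omega
  rw [factor_nilGen_apply, factor_nilGen_apply, hb u v hu hv, glue_comp_swap_left hk,
    glue_comp_swap_left hk, hb _ v hu' hv]
  simp only [glue, hk, show k < m by omega, if_true]
  split_ifs <;> ring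

theorem FactorsThrough.factor_right {m k : ℕ} (hk : m ≤ k + 1) (x : R) {f a : (ℕ → ℕ) → R}
    (h : FactorsThrough m f a) : FactorsThrough m (factor (nilGen R) k x f) a := by
  obtain ⟨b, hb⟩ := h
  rcases hk.lt_or_eq with hk | rfl
  · refine ⟨factor (nilGen R) k x b, fun u v hu hv => ?_⟩
    have hv' : ∀ i, m ≤ i → m ≤ (v ∘ Equiv.swap k (k + 1)) i := fun i hi => by
      refine hv _ ?_
      rw [Equiv.swap_apply_def]
      split_ifs <;> omega
    rw [factor_nilGen_apply, factor_nilGen_apply, hb u v hu hv, glue_comp_swap_right (by omega),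
      hb u _ hu hv']
    simp only [glue, show ¬ k < m by omega, show ¬ k + 1 < m by omega, if_false]
    split_ifs <;> ring
  · refine ⟨b, fun u v hu hv => ?_⟩
    -- the letter crossing the cut contributes nothing, since `u k ≤ k < v (k + 1)`
    have h1 := hu k (by omega)
    have h2 := hv (k + 1) le_rfl
    rw [factor_nilGen_apply, hb u v hu hv]
    simp only [glue, show k < k + 1 by omega, show ¬ k + 1 < k + 1 by omega, if_true, if_false,
      show ¬ v (k + 1) < u k by omega, mul_zero, add_zero]

theorem FactorsThrough.ladder {m N i : ℕ} (hm : m ≤ N + 1) (x : R) {f a : (ℕ → ℕ) → R}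
    (h : FactorsThrough m f a) :
    FactorsThrough m (ladder (nilGen R) i (N - i) x f)
      (ladder (nilGen R) i (m - 1 - i) x a) := by
  induction d : N - i generalizing i with
  | zero =>
    rw [show m - 1 - i = 0 by omega]
    exact h
  | succ d ih =>
    rw [ladder_succ, Module.End.mul_apply]
    have h' := ih (i := i + 1) (by omega)
    by_cases hi : i + 1 < m
    · rw [show m - 1 - i = m - 1 - (i + 1) + 1 by omega, ladder_succ, Module.End.mul_apply]
      exact h'.factor_left hi x
    · rw [show m - 1 - i = m - 1 - (i + 1) by omega]
      rw [show m - 1 - (i + 1) = 0 by omega] at h' ⊢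
      exact h'.factor_right (by omega) x

theorem FactorsThrough.ladders {m N i : ℕ} (hm : m ≤ N + 1) (x : ℕ → R) {f a : (ℕ → ℕ) → R}
    (h : FactorsThrough m f a) :
    FactorsThrough m (ladders (nilGen R) i (N - i) x f)
      (ladders (nilGen R) i (m - 1 - i) x a) := by
  induction d : N - i generalizing i f a with
  | zero =>
    rw [show m - 1 - i = 0 by omega]
    exact h
  | succ d ih =>
    have h1 := h.ladder (i := i) hm (x i)
    have h2 := ih (i := i + 1) h1 (by omega)
    rw [d] at h1 h2
    rw [Schubert.ladders, Module.End.mul_apply]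
    by_cases hi : i + 1 < m
    · rw [show m - 1 - i = m - 1 - (i + 1) + 1 by omega] at h2 ⊢
      exact h2
    · rw [show m - 1 - i = 0 by omega, show m - 1 - (i + 1) = 0 by omega] at h2
      rw [show m - 1 - i = 0 by omega]
      exact h2

theorem factorsThrough_nilOne (m : ℕ) : FactorsThrough m (nilOne R) (nilOne R) := by
  refine ⟨fun v => nilOne R (glue m id v), fun u v _ _ => ?_⟩
  simp only [nilOne]
  have : glue m u v = id ↔ glue m u id = id ∧ glue m id v = id := by
    simp only [funext_iff, glue, id]
    refine ⟨fun h => ⟨fun i => ?_, fun i => ?_⟩, fun h i => ?_⟩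
    · have := h i; split_ifs at * <;> simp_all
    · have := h i; split_ifs at * <;> simp_all
    · have h1 := h.1 i; have h2 := h.2 i; split_ifs at * <;> simp_all
  by_cases h1 : glue m u id = id <;> by_cases h2 : glue m id v = id <;> simp [this, h1, h2]

theorem glue_id_id (m : ℕ) : glue m id id = id := by
  ext i; simp [glue]

/-- The Schubert polynomial of a direct sum is a product. -/
theorem schubertValue_glue {m n : ℕ} (hm : m ≤ n) (x : ℕ → R) {u v : ℕ → ℕ}
    (hu : ∀ i, i < m → u i < m) (hv : ∀ i, m ≤ i → m ≤ v i) :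
    schubertValue n x (glue m u v) =
      schubertValue m x (glue m u id) * schubertValue n x (glue m id v) := by
  obtain ⟨b, hb⟩ := (factorsThrough_nilOne (R := R) m).ladders (N := n - 1) (i := 0)
    (by omega) x
  simp only [Nat.sub_zero] at hb
  have h1 := hb u v hu hv
  have h2 := hb id v (fun i hi => hi) hv
  have h3 := schubertValue_id m x
  rw [glue_id_id] at h2
  simp only [schubertValue] at h3 ⊢
  rw [h1, h2, h3, one_mul]

/-- The Schubert polynomial of a permutation of `0, …, m - 1` does not depend on the size of the
symmetric group. -/
theorem schubertValue_stable {m n : ℕ} (hm : m ≤ n) (x : ℕ → R) {u : ℕ → ℕ}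
    (hu : ∀ i, i < m → u i < m) (hu' : ∀ i, m ≤ i → u i = i) :
    schubertValue n x u = schubertValue m x u := by
  have h := schubertValue_glue hm x hu (v := id) fun i hi => hi
  have hg : glue m u id = u := by
    ext i
    by_cases hi : i < m
    · simp [glue, hi]
    · simp [glue, hi, hu' i (by omega)]
  rw [hg, glue_id_id, schubertValue_id, mul_one] at h
  exact h

end Values

/-! ### The longest permutation -/

section Longest

variable {R : Type*} [CommRing R]

/-- The permutation reversing `0, …, n - 1`. -/
def reversal (n i : ℕ) : ℕ := if i < n then n - 1 - i else i

/-- The cycle moving the value `i + k` to position `i`. -/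
def bigCycle (i k j : ℕ) : ℕ :=
  if j < i then j else if j = i then i + k else if j ≤ i + k then j - 1 else j

theorem ladder_nilGen_support {i j : ℕ} (hij : i < j) (k : ℕ) (x : R) {f : (ℕ → ℕ) → R}
    (hf : ∀ w : ℕ → ℕ, w i ≠ i → f w = 0) {w : ℕ → ℕ} (hw : w i ≠ i) :
    ladder (nilGen R) j k x f w = 0 := by
  induction k generalizing j w with
  | zero => exact hf w hw
  | succ k ih =>
    have h : (w ∘ Equiv.swap j (j + 1)) i ≠ i := by
      simpa [Equiv.swap_apply_of_ne_of_ne (show i ≠ j by omega) (show i ≠ j + 1 by omega)] using hw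
    rw [ladder, Module.End.mul_apply, factor_nilGen_apply, ih (by omega) hw, ih (by omega) h]
    simp

open Classical in
theorem ladder_nilGen_nilOne {i k : ℕ} (x : R) {w : ℕ → ℕ} (hw : w i = i + k) :
    ladder (nilGen R) i k x (nilOne R) w = if w = bigCycle i k then x ^ k else 0 := by
  induction k generalizing i w with
  | zero =>
    have : bigCycle i 0 = id := by
      ext j; simp only [bigCycle, id]; split_ifs <;> omega
    simp [ladder, nilOne, this]
  | succ k ih =>
    have hs : ∀ w : ℕ → ℕ, w i ≠ i → nilOne R w = 0 := fun w hw => by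
      have : w ≠ id := fun h => hw (by simp [h])
      simp [nilOne, this]
    have h1 : ladder (nilGen R) (i + 1) k x (nilOne R) w = 0 :=
      ladder_nilGen_support (by omega) k x hs (by omega)
    have h2 : (w ∘ Equiv.swap i (i + 1)) (i + 1) = i + 1 + k := by simp [hw]; omega
    have h3 : w ∘ Equiv.swap i (i + 1) = bigCycle (i + 1) k ↔ w = bigCycle i (k + 1) := by
      constructor <;> intro h
      · ext j
        have := congrFun h (Equiv.swap i (i + 1) j)
        simp only [Function.comp, Equiv.swap_apply_self] at this
        rw [this]
        simp only [bigCycle, Equiv.swap_apply_def]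
        split_ifs <;> omega
      · ext j
        simp only [h, Function.comp, bigCycle, Equiv.swap_apply_def]
        split_ifs <;> omega
    rw [ladder, Module.End.mul_apply, factor_nilGen_apply, h1, ih h2]
    simp only [h3]
    by_cases h : w = bigCycle i (k + 1)
    · have : w (i + 1) < w i := by
        rw [h]; simp only [bigCycle]; split_ifs <;> omega
      rw [if_pos this, if_pos h, if_pos h]; ring
    · simp [h]

/-- The permutation obtained by deleting the first entry, when that is the largest one. -/
def dropFirst (n : ℕ) (w : ℕ → ℕ) (i : ℕ) : ℕ := if i < n then w (i + 1) else i

/-- `f` at the permutations starting with their largest entry `n` is `c` times `g`, once that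
entry is deleted. -/
def DropsTo (n : ℕ) (c : R) (f g : (ℕ → ℕ) → R) : Prop :=
  ∀ w : ℕ → ℕ, w 0 = n → (∀ i, n < i → w i = i) → f w = c * g (dropFirst n w)

theorem DropsTo.factor {n k : ℕ} (hk : k + 2 ≤ n) {c : R} (x : R) {f g : (ℕ → ℕ) → R}
    (h : DropsTo n c f g) :
    DropsTo n c (factor (nilGen R) (k + 1) x f) (factor (nilGen R) k x g) := by
  intro w h0 hw
  have h0' : (w ∘ Equiv.swap (k + 1) (k + 1 + 1)) 0 = n := by
    simp [Equiv.swap_apply_of_ne_of_ne (show 0 ≠ k + 1 by omega) (show 0 ≠ k + 1 + 1 by omega), h0]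
  have hw' : ∀ i, n < i → (w ∘ Equiv.swap (k + 1) (k + 1 + 1)) i = i := fun i hi => by
    simp [Equiv.swap_apply_of_ne_of_ne (show i ≠ k + 1 by omega) (show i ≠ k + 1 + 1 by omega),
      hw i hi]
  have hd : dropFirst n (w ∘ Equiv.swap (k + 1) (k + 1 + 1)) =
      dropFirst n w ∘ Equiv.swap k (k + 1) := by
    ext i
    simp only [dropFirst, Function.comp, Equiv.swap_apply_def]
    split_ifs <;> first | rfl | omega
  rw [factor_nilGen_apply, factor_nilGen_apply, h w h0 hw, h _ h0' hw', hd]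
  simp only [dropFirst, show k < n by omega, show k + 1 < n by omega, if_true]
  split_ifs <;> ring

theorem DropsTo.ladder {n i k : ℕ} (hk : i + k + 1 ≤ n) {c : R} (x : R) {f g : (ℕ → ℕ) → R}
    (h : DropsTo n c f g) :
    DropsTo n c (ladder (nilGen R) (i + 1) k x f) (ladder (nilGen R) i k x g) := by
  induction k generalizing i with
  | zero => exact h
  | succ k ih => exact (ih (i := i + 1) (by omega)).factor (by omega) x

theorem DropsTo.ladders {n i k : ℕ} (hk : i + k + 1 ≤ n) {c : R} (x : ℕ → R)
    {f g : (ℕ → ℕ) → R} (h : DropsTo n c f g) :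
    DropsTo n c (ladders (nilGen R) (i + 1) k x f)
      (ladders (nilGen R) i k (fun j => x (j + 1)) g) := by
  induction k generalizing i f g with
  | zero => exact h
  | succ k ih => exact ih (i := i + 1) (by omega) (h.ladder hk (x (i + 1)))

/-- If the first entry of a permutation is the largest one, it contributes a power of the first
variable to the Schubert polynomial. -/
theorem schubertValue_first_largest {n : ℕ} (x : ℕ → R) {w : ℕ → ℕ} (h0 : w 0 = n)
    (hw : ∀ i, n < i → w i = i) :
    schubertValue (n + 1) x w =
      x 0 ^ n * schubertValue n (fun j => x (j + 1)) (dropFirst n w) := by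
  have hb : DropsTo n (x 0 ^ n) (Schubert.ladder (nilGen R) 0 n (x 0) (nilOne R)) (nilOne R) := by
    classical
    intro w h0 hw
    rw [ladder_nilGen_nilOne _ (by omega), nilOne]
    have : w = bigCycle 0 n ↔ dropFirst n w = id := by
      constructor <;> intro h
      · ext i
        simp only [h, dropFirst, bigCycle, id]
        split_ifs <;> first | contradiction | omega
      · ext i
        rcases i with _ | i
        · simp [h0, bigCycle]
        · have := congrFun h i
          simp only [dropFirst, id] at this
          simp only [bigCycle]
          by_cases hi : i < n
          · simp only [hi, if_true] at this
            rw [this]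
            split_ifs <;> first | contradiction | omega
          · rw [hw _ (by omega)]
            split_ifs <;> first | contradiction | omega
    simp [this]
  rcases n with _ | n
  · have : w = id := by
      ext i
      rcases i with _ | i
      · exact h0
      · exact hw _ (by omega)
    have h' : dropFirst 0 w = id := by ext i; simp [dropFirst]
    rw [h', this, schubertValue_id, schubertValue_id]
    simp
  · exact (hb.ladders (i := 0) (k := n) (by omega) x) w h0 hw

/-- The Schubert polynomial of the longest permutation is a monomial. -/
theorem schubertValue_reversal (n : ℕ) (x : ℕ → R) :
    schubertValue n x (reversal n) = ∏ i ∈ Finset.range n, x i ^ (n - 1 - i) := by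
  induction n generalizing x with
  | zero =>
    have : reversal 0 = id := by ext i; simp [reversal]
    rw [this, schubertValue_id]
    simp
  | succ n ih =>
    have hd : dropFirst n (reversal (n + 1)) = reversal n := by
      ext i; simp only [dropFirst, reversal]; split_ifs <;> omega
    rw [schubertValue_first_largest x (by simp [reversal])
      (fun i hi => by simp only [reversal]; split_ifs <;> omega), hd, ih,
      Finset.prod_range_succ', mul_comm]
    congr 1
    exact Finset.prod_congr rfl fun i _ => by congr 1; omega

end Longest

/-! ### Complete homogeneous polynomials -/

section Homogeneous

variable {R S : Type*} [CommRing R] [CommRing S]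

/-- The value at `x` of the complete homogeneous polynomial of degree `k` in the first `f`
variables. -/
def completeHom (x : ℕ → R) : ℕ → ℕ → R
  | _, 0 => 1
  | 0, _ + 1 => 0
  | f + 1, k + 1 => completeHom x f (k + 1) + x f * completeHom x (f + 1) k

/-- The same for an integral degree: complete homogeneous polynomials of negative degree
vanish. -/
def completeHomInt (x : ℕ → R) (f : ℕ) (k : ℤ) : R :=
  if k < 0 then 0 else completeHom x f k.toNat

theorem completeHomInt_of_neg (x : ℕ → R) (f : ℕ) {k : ℤ} (hk : k < 0) :
    completeHomInt x f k = 0 := if_pos hk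

theorem completeHomInt_natCast (x : ℕ → R) (f k : ℕ) :
    completeHomInt x f k = completeHom x f k := by
  simp [completeHomInt]

theorem completeHom_zero (x : ℕ → R) (f : ℕ) : completeHom x f 0 = 1 := by
  cases f <;> rw [completeHom]

theorem completeHomInt_zero (x : ℕ → R) (f : ℕ) : completeHomInt x f 0 = 1 := by
  simp [completeHomInt, completeHom_zero]

theorem completeHomInt_succ (x : ℕ → R) (f : ℕ) (k : ℤ) :
    completeHomInt x (f + 1) k =
      completeHomInt x f k + x f * completeHomInt x (f + 1) (k - 1) := by
  rcases lt_trichotomy k 0 with hk | rfl | hk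
  · simp [completeHomInt_of_neg, hk, show k - 1 < 0 by omega]
  · simp [completeHomInt_zero, completeHomInt_of_neg]
  · obtain ⟨m, rfl⟩ : ∃ m : ℕ, k = (m : ℤ) + 1 := ⟨(k - 1).toNat, by omega⟩
    have h : ((m : ℤ) + 1) = ((m + 1 : ℕ) : ℤ) := by push_cast; rfl
    rw [add_sub_cancel_right, h, completeHomInt_natCast, completeHomInt_natCast,
      completeHomInt_natCast, completeHom]

theorem completeHomInt_map (φ : R →+* S) (x : ℕ → R) (f : ℕ) (k : ℤ) :
    φ (completeHomInt x f k) = completeHomInt (φ ∘ x) f k := by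
  have h : ∀ f k, φ (completeHom x f k) = completeHom (φ ∘ x) f k := by
    intro f
    induction f with
    | zero => intro k; cases k <;> simp [completeHom]
    | succ f ih =>
      intro k
      induction k with
      | zero => simp [completeHom]
      | succ k ih' => simp [completeHom, ih, ih']
  simp only [completeHomInt]
  split_ifs <;> simp [h]

theorem completeHomInt_congr {x y : ℕ → R} {f : ℕ} (h : ∀ i, i < f → x i = y i) (k : ℤ) :
    completeHomInt x f k = completeHomInt y f k := by
  have h' : ∀ f, (∀ i, i < f → x i = y i) → ∀ k, completeHom x f k = completeHom y f k := by
    intro f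
    induction f with
    | zero => intro _ k; cases k <;> simp [completeHom]
    | succ f ih =>
      intro hf k
      induction k with
      | zero => simp [completeHom]
      | succ k ih' =>
        rw [completeHom, completeHom, ih (fun i hi => hf i (by omega)), ih', hf f (by omega)]
  simp only [completeHomInt, h' f h]

/-- Complete homogeneous polynomials are symmetric. -/
theorem completeHomInt_swap (x : ℕ → R) {a f : ℕ} (hf : f ≠ a + 1) (k : ℤ) :
    completeHomInt (x ∘ Equiv.swap a (a + 1)) f k = completeHomInt x f k := by
  rcases (show f ≤ a ∨ a + 2 ≤ f by omega) with h | h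
  · exact completeHomInt_congr (fun i hi => by
      simp [Equiv.swap_apply_of_ne_of_ne (show i ≠ a by omega) (show i ≠ a + 1 by omega)]) k
  · -- in terms of smaller degrees and of the variables before `a`, both sides satisfy the same
    -- recursion, which involves `x a` and `x (a + 1)` symmetrically only
    have key : ∀ y : ℕ → R, ∀ k, completeHomInt y (a + 2) k = completeHomInt y a k +
        (y a + y (a + 1)) * completeHomInt y (a + 2) (k - 1) -
        y a * y (a + 1) * completeHomInt y (a + 2) (k - 1 - 1) := by
      intro y k
      have h1 := completeHomInt_succ y (a + 1) k
      have h2 := completeHomInt_succ y a k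
      have h3 := completeHomInt_succ y (a + 1) (k - 1)
      linear_combination h1 + h2 - y a * h3
    have h0 : ∀ k, completeHomInt (x ∘ Equiv.swap a (a + 1)) a k = completeHomInt x a k :=
      fun k => completeHomInt_congr (fun i hi => by
        simp [Equiv.swap_apply_of_ne_of_ne (show i ≠ a by omega) (show i ≠ a + 1 by omega)]) k
    have base : ∀ m : ℕ, ∀ k : ℤ, k < m →
        completeHomInt (x ∘ Equiv.swap a (a + 1)) (a + 2) k = completeHomInt x (a + 2) k := by
      intro m
      induction m with
      | zero => intro k hk; rw [completeHomInt_of_neg _ _ (by simpa using hk),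
          completeHomInt_of_neg _ _ (by simpa using hk)]
      | succ m ih =>
        intro k hk
        rw [key, key x, h0, ih _ (by push_cast at hk; omega), ih _ (by push_cast at hk; omega)]
        simp only [Function.comp, Equiv.swap_apply_left, Equiv.swap_apply_right]
        ring
    have step : ∀ d : ℕ, ∀ m : ℕ, ∀ k : ℤ, k < m →
        completeHomInt (x ∘ Equiv.swap a (a + 1)) (a + 2 + d) k =
          completeHomInt x (a + 2 + d) k := by
      intro d
      induction d with
      | zero => exact base
      | succ d ihd =>
        intro m
        induction m with
        | zero => intro k hk; rw [completeHomInt_of_neg _ _ (by simpa using hk),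
            completeHomInt_of_neg _ _ (by simpa using hk)]
        | succ m ih =>
          intro k hk
          rw [← add_assoc, completeHomInt_succ, completeHomInt_succ x, ihd (m + 1) k hk,
            add_assoc (a + 2), ih _ (by push_cast at hk; omega)]
          simp [Equiv.swap_apply_of_ne_of_ne (show a + 2 + d ≠ a by omega)
            (show a + 2 + d ≠ a + 1 by omega)]
    obtain ⟨d, rfl⟩ := Nat.exists_eq_add_of_le h
    exact step d (k.toNat + 1) k (by omega)

/-- The divided difference of a complete homogeneous polynomial. -/
theorem completeHomInt_divided_difference (x : ℕ → R) (a : ℕ) (k : ℤ) :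
    (x a - x (a + 1)) * completeHomInt x (a + 2) (k - 1) =
      completeHomInt x (a + 1) k - completeHomInt (x ∘ Equiv.swap a (a + 1)) (a + 1) k := by
  have h1 := completeHomInt_succ x (a + 1) k
  have h2 := completeHomInt_succ (x ∘ Equiv.swap a (a + 1)) (a + 1) k
  rw [completeHomInt_swap x (f := a + 1 + 1) (by omega),
    completeHomInt_swap x (f := a + 1 + 1) (by omega)] at h2
  simp only [Function.comp, Equiv.swap_apply_right] at h2 ⊢
  linear_combination h1 - h2

/-- The recursion splitting off the first variable. -/
theorem completeHomInt_succ' (x : ℕ → R) (f : ℕ) (k : ℤ) :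
    completeHomInt x (f + 1) k =
      completeHomInt (fun i => x (i + 1)) f k + x 0 * completeHomInt x (f + 1) (k - 1) := by
  induction f generalizing k with
  | zero =>
    rw [completeHomInt_succ,
      completeHomInt_congr (x := fun i => x (i + 1)) (y := x) (f := 0) (fun i hi => by omega)]
  | succ f ih =>
    have base : ∀ m : ℕ, ∀ k : ℤ, k < m → completeHomInt x (f + 1 + 1) k =
        completeHomInt (fun i => x (i + 1)) (f + 1) k +
          x 0 * completeHomInt x (f + 1 + 1) (k - 1) := by
      intro m
      induction m with
      | zero =>
        intro k hk
        have hk' : k < 0 := by simpa using hk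
        simp [completeHomInt_of_neg, hk', show k - 1 < 0 by omega]
      | succ m ihm =>
        intro k hk
        have h1 := completeHomInt_succ x (f + 1) k
        have h2 := completeHomInt_succ x (f + 1) (k - 1)
        have h3 := completeHomInt_succ (fun i => x (i + 1)) f k
        have h4 := ihm (k - 1) (by push_cast at hk; omega)
        have h5 := ih k
        linear_combination h1 + h5 + x (f + 1) * h4 - x 0 * h2 - h3
    exact base (k.toNat + 1) k (by omega)

theorem completeHom_one (f k : ℕ) :
    completeHom (fun _ => (1 : R)) f k = ((f + k - 1).choose k : ℕ) := by
  induction f generalizing k with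
  | zero => cases k <;> simp [completeHom]
  | succ f ih =>
    induction k with
    | zero => simp [completeHom]
    | succ k ih' =>
      rw [completeHom, ih, ih', show f + 1 + (k + 1) - 1 = f + k + 1 by omega,
        show f + (k + 1) - 1 = f + k by omega, show f + 1 + k - 1 = f + k by omega,
        Nat.choose_succ_succ]
      push_cast
      ring

end Homogeneous

/-! ### Flagged determinants -/

section Flagged

variable {R S : Type*} [CommRing R] [CommRing S]

/-- The determinant of the flagged Jacobi–Trudi matrix with `r` rows: if `l i = (m, f)`, the
row of index `i` consists of the complete homogeneous polynomials of degrees `m - i + j` in `f`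
variables. -/
def flagMatrix (x : ℕ → R) (r : ℕ) (l : ℕ → ℕ × ℕ) : Matrix (Fin r) (Fin r) R :=
  .of fun i j => completeHomInt x (l i).2 ((l i).1 - i + j)

theorem det_flagMatrix_map (φ : R →+* S) (x : ℕ → R) (r : ℕ) (l : ℕ → ℕ × ℕ) :
    φ (flagMatrix x r l).det = (flagMatrix (φ ∘ x) r l).det := by
  rw [RingHom.map_det]
  congr 1
  ext i j
  simp [flagMatrix, completeHomInt_map]

theorem flagMatrix_congr (x : ℕ → R) {r : ℕ} {l l' : ℕ → ℕ × ℕ} (h : ∀ i, i < r → l i = l' i) :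
    flagMatrix x r l = flagMatrix x r l' := by
  ext i j
  simp [flagMatrix, h i i.2]

theorem flagMatrix_update (x : ℕ → R) (r : ℕ) (l : ℕ → ℕ × ℕ) (k : Fin r) (p : ℕ × ℕ) :
    flagMatrix x r (Function.update l k p) =
      (flagMatrix x r l).updateRow k fun j => completeHomInt x p.2 (p.1 - (k : ℕ) + j) := by
  ext i j
  by_cases h : i = k
  · subst h; simp [flagMatrix]
  · have : (i : ℕ) ≠ k := fun e => h (Fin.ext e)
    simp [flagMatrix, Matrix.updateRow_ne h, Function.update_of_ne this]

/-- The flag of a row may be raised to that of the next row, if they differ by one and the rows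
belong to equal parts. -/
theorem det_flagMatrix_raise (x : ℕ → R) {r k m f : ℕ} {l : ℕ → ℕ × ℕ} (hk : k + 1 < r)
    (h1 : l k = (m, f)) (h2 : l (k + 1) = (m, f + 1)) :
    (flagMatrix x r (Function.update l k (m, f + 1))).det = (flagMatrix x r l).det := by
  have e : (⟨k, by omega⟩ : Fin r) ≠ ⟨k + 1, hk⟩ := by simp
  have h := flagMatrix_update x r l ⟨k, by omega⟩ (m, f + 1)
  rw [← Matrix.det_updateRow_add_smul_self (flagMatrix x r l) e (x f)]
  simp only at h
  rw [h]
  congr 2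
  ext j
  simp only [flagMatrix, Matrix.of_apply, h1, h2, Pi.add_apply, Pi.smul_apply, smul_eq_mul]
  rw [completeHomInt_succ]
  push_cast
  ring_nf

/-- A last row belonging to a zero part may be dropped. -/
theorem det_flagMatrix_drop (x : ℕ → R) {r f : ℕ} {l : ℕ → ℕ × ℕ} (h : l r = (0, f)) :
    (flagMatrix x (r + 1) l).det = (flagMatrix x r l).det := by
  rw [Matrix.det_succ_row _ (Fin.last r), Finset.sum_eq_single (Fin.last r)]
  · have : (flagMatrix x (r + 1) l).submatrix (Fin.last r).succAbove (Fin.last r).succAbove =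
        flagMatrix x r l := by
      ext i j
      simp [flagMatrix]
    rw [this]
    simp [flagMatrix, h, completeHomInt_zero, ← two_mul]
  · intro j _ hj
    have : (j : ℕ) < r := by
      have := j.2
      have : (j : ℕ) ≠ r := fun e => hj (Fin.ext e)
      omega
    simp [flagMatrix, h, completeHomInt_of_neg x f (show -(r : ℤ) + j < 0 by omega)]
  · simp

/-- The divided difference of a flagged determinant in which a single row has the flag `a + 1`. -/
theorem det_flagMatrix_divided_difference (x : ℕ → R) {r k m a : ℕ} {l : ℕ → ℕ × ℕ} (hk : k < r)
    (h1 : l k = (m + 1, a + 1)) (h2 : ∀ i, i < r → i ≠ k → (l i).2 ≠ a + 1) :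
    (x a - x (a + 1)) * (flagMatrix x r (Function.update l k (m, a + 2))).det =
      (flagMatrix x r l).det - (flagMatrix (x ∘ Equiv.swap a (a + 1)) r l).det := by
  have hu := flagMatrix_update x r l ⟨k, hk⟩ (m, a + 2)
  simp only at hu
  have h3 : flagMatrix (x ∘ Equiv.swap a (a + 1)) r l = (flagMatrix x r l).updateRow ⟨k, hk⟩
      (flagMatrix (x ∘ Equiv.swap a (a + 1)) r l ⟨k, hk⟩) := by
    ext i j
    by_cases h : i = ⟨k, hk⟩
    · subst h; simp
    · have : (i : ℕ) ≠ k := fun e => h (Fin.ext e)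
      rw [Matrix.updateRow_ne h]
      exact completeHomInt_swap x (h2 i i.2 this) _
  have h4 : flagMatrix x r l = (flagMatrix x r l).updateRow ⟨k, hk⟩
      ((x a - x (a + 1)) • (fun j : Fin r => completeHomInt x (a + 2) ((m : ℤ) - k + (j : ℕ))) +
        flagMatrix (x ∘ Equiv.swap a (a + 1)) r l ⟨k, hk⟩) := by
    conv_lhs => rw [← Matrix.updateRow_eq_self (flagMatrix x r l) ⟨k, hk⟩]
    congr 1
    ext j
    have := completeHomInt_divided_difference x a ((m + 1 : ℕ) - k + (j : ℕ))
    rw [show ((m + 1 : ℕ) : ℤ) - k + (j : ℕ) - 1 = m - k + (j : ℕ) by push_cast; ring] at this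
    simp only [flagMatrix, Matrix.of_apply, h1, Pi.add_apply, Pi.smul_apply, smul_eq_mul, this]
    ring
  rw [hu]
  conv_rhs => rw [h3]
  conv_rhs => enter [1]; rw [h4]
  rw [Matrix.det_updateRow_add, Matrix.det_updateRow_smul, add_sub_cancel_right]

/-- The flagged determinant of the longest permutation. -/
theorem det_flagMatrix_staircase (x : ℕ → R) (n : ℕ) :
    (flagMatrix x n fun i => (n - 1 - i, i + 1)).det = ∏ i ∈ Finset.range n, x i ^ (n - 1 - i) := by
  induction n generalizing x with
  | zero => simp
  | succ n ih =>
    -- subtracting from each column `x 0` times the preceding one removes the first variable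
    let B : Matrix (Fin (n + 1)) (Fin (n + 1)) R := .of fun i j =>
      Fin.cases (completeHomInt x ((i : ℕ) + 1) (((n - i : ℕ) : ℤ) - (i : ℕ)))
        (fun j => completeHomInt (fun i => x (i + 1)) i (((n - i : ℕ) : ℤ) - (i : ℕ) + j + 1)) j
    have h1 : (flagMatrix x (n + 1) fun i => (n + 1 - 1 - i, i + 1)).det = B.det := by
      refine Matrix.det_eq_of_forall_col_eq_smul_add_pred (fun _ => x 0) (fun i => ?_)
        fun i j => ?_
      · simp [flagMatrix, B]
      · simp only [flagMatrix, Matrix.of_apply, B, Fin.cases_succ, add_tsub_cancel_right]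
        rw [completeHomInt_succ']
        simp only [Fin.val_succ, Fin.val_castSucc, Nat.cast_add, Nat.cast_one]
        congr 2
        · ring
        · congr 1; ring
    have h2 : ∀ d : ℕ, completeHom x 1 d = x 0 ^ d := by
      intro d
      induction d with
      | zero => simp [completeHom]
      | succ d ihd => rw [completeHom, completeHom, ihd]; ring
    have h3 : B 0 0 = x 0 ^ n := by
      simp only [B, Matrix.of_apply, Fin.cases_zero]
      simpa [h2] using completeHomInt_natCast x 1 n
    have h4 : ∀ j : Fin n, B 0 j.succ = 0 := by
      intro j
      simp only [B, Matrix.of_apply, Fin.cases_succ]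
      have := completeHomInt_natCast (fun i => x (i + 1)) 0 (n + j + 1)
      simpa [completeHom] using this
    have h5 : B.submatrix Fin.succ (Fin.succAbove 0) =
        flagMatrix (fun i => x (i + 1)) n fun i => (n - 1 - i, i + 1) := by
      ext i j
      simp only [B, Matrix.submatrix_apply, Matrix.of_apply, Fin.succAbove_zero, Fin.cases_succ,
        flagMatrix, Fin.val_succ]
      congr 1
      have := i.2
      omega
    rw [h1, Matrix.det_succ_row_zero, Fin.sum_univ_succ, h3, h5, ih, Finset.prod_range_succ']
    simp only [h4, mul_zero, zero_mul, Finset.sum_const_zero, add_zero, Fin.val_zero, pow_zero,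
      one_mul]
    rw [mul_comm]
    congr 1
    exact Finset.prod_congr rfl fun i _ => by congr 1; omega

end Flagged

/-! ### Deriving determinantal formulas -/

open MvPolynomial in
/-- The flagged determinant, as a polynomial, with a given list of rows. -/
noncomputable def flagPoly (L : List (ℕ × ℕ)) : MvPolynomial ℕ ℤ :=
  (flagMatrix X L.length fun i => L.getD i (0, 0)).det

open MvPolynomial in
theorem flagPoly_eq_det {r : ℕ} {L : List (ℕ × ℕ)} (hr : r = L.length) :
    flagPoly L = (flagMatrix X r fun i => L.getD i (0, 0)).det := by
  subst hr
  rfl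

/-- Rows which may replace one another at the end of a flagged determinant. -/
def RowsEquiv (L L' : List (ℕ × ℕ)) : Prop :=
  ∀ L₀ : List (ℕ × ℕ), flagPoly (L₀ ++ L) = flagPoly (L₀ ++ L')

theorem RowsEquiv.refl (L : List (ℕ × ℕ)) : RowsEquiv L L := fun _ => rfl

theorem RowsEquiv.symm {L L' : List (ℕ × ℕ)} (h : RowsEquiv L L') : RowsEquiv L' L :=
  fun L₀ => (h L₀).symm

theorem RowsEquiv.trans {L L' L'' : List (ℕ × ℕ)} (h : RowsEquiv L L') (h' : RowsEquiv L' L'') :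
    RowsEquiv L L'' := fun L₀ => (h L₀).trans (h' L₀)

theorem RowsEquiv.cons {L L' : List (ℕ × ℕ)} (h : RowsEquiv L L') (p : ℕ × ℕ) :
    RowsEquiv (p :: L) (p :: L') := fun L₀ => by
  simpa using h (L₀ ++ [p])

theorem RowsEquiv.flagPoly_eq {L L' : List (ℕ × ℕ)} (h : RowsEquiv L L') :
    flagPoly L = flagPoly L' := h []

theorem RowsEquiv.iterate {g : List (ℕ × ℕ) → List (ℕ × ℕ)} (h : ∀ L, RowsEquiv L (g L)) (k : ℕ)
    (L : List (ℕ × ℕ)) : RowsEquiv L (g^[k] L) := by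
  induction k generalizing L with
  | zero => exact .refl L
  | succ k ih => exact (h L).trans (ih (g L))

theorem getD_append_cons (L₀ L : List (ℕ × ℕ)) (p q : ℕ × ℕ) :
    (fun i => (L₀ ++ q :: L).getD i (0, 0)) =
      Function.update (fun i => (L₀ ++ p :: L).getD i (0, 0)) L₀.length q := by
  funext i
  rcases lt_trichotomy i L₀.length with h | rfl | h
  · rw [Function.update_of_ne (by omega), List.getD_append _ _ _ _ h, List.getD_append _ _ _ _ h]
  · simp
  · obtain ⟨j, rfl⟩ : ∃ j, i = L₀.length + (j + 1) := ⟨i - L₀.length - 1, by omega⟩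
    rw [Function.update_of_ne (by omega), List.getD_append_right _ _ _ _ (by omega),
      List.getD_append_right _ _ _ _ (by omega)]
    simp

theorem rowsEquiv_raise (m f : ℕ) (L : List (ℕ × ℕ)) :
    RowsEquiv ((m, f) :: (m, f + 1) :: L) ((m, f + 1) :: (m, f + 1) :: L) := by
  intro L₀
  have h := det_flagMatrix_raise (MvPolynomial.X (R := ℤ))
    (r := (L₀ ++ (m, f) :: (m, f + 1) :: L).length) (k := L₀.length) (m := m) (f := f)
    (l := fun i => (L₀ ++ (m, f) :: (m, f + 1) :: L).getD i (0, 0))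
    (by simp) (by simp) (by rw [List.getD_append_right _ _ _ _ (by omega)]; simp)
  rw [← getD_append_cons] at h
  rw [flagPoly, ← h]
  exact (flagPoly_eq_det (by simp)).symm

theorem rowsEquiv_drop (f : ℕ) : RowsEquiv [(0, f)] [] := by
  intro L₀
  have h := det_flagMatrix_drop (MvPolynomial.X (R := ℤ)) (r := L₀.length) (f := f)
    (l := fun i => (L₀ ++ [(0, f)]).getD i (0, 0)) (by simp)
  rw [flagPoly, flagPoly, List.length_append, List.append_nil]
  refine h.trans (congrArg _ (flagMatrix_congr _ fun i hi => ?_))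
  exact List.getD_append _ _ _ _ hi

/-- Lower flags where two successive rows are equal, and drop a last row belonging to a zero
part. -/
def lowerFlags : List (ℕ × ℕ) → List (ℕ × ℕ)
  | [] => []
  | (m, f) :: L =>
    match L with
    | [] => bif Nat.beq m 0 then [] else [(m, f)]
    | (m', f') :: _ => (m, bif Nat.beq m m' && Nat.beq f f' then f - 1 else f) :: lowerFlags L

/-- Raise flags where two successive rows belong to equal parts and have successive flags. -/
def raiseFlags : List (ℕ × ℕ) → List (ℕ × ℕ)
  | [] => []
  | (m, f) :: L =>
    match L with
    | [] => [(m, f)]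
    | (m', f') :: _ =>
      (m, bif Nat.beq m m' && Nat.beq (f + 1) f' then f + 1 else f) :: raiseFlags L

theorem rowsEquiv_lowerFlags (L : List (ℕ × ℕ)) : RowsEquiv L (lowerFlags L) := by
  induction L with
  | nil => exact .refl _
  | cons p L ih =>
    obtain ⟨m, f⟩ := p
    rcases L with _ | ⟨⟨m', f'⟩, L⟩
    · rcases m with _ | m
      · exact rowsEquiv_drop f
      · exact .refl _
    · refine RowsEquiv.trans ?_ (ih.cons _)
      by_cases h : m = m' ∧ f = f'
      · obtain ⟨rfl, rfl⟩ := h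
        rcases f with _ | f
        · simp [RowsEquiv.refl]
        · simpa using (rowsEquiv_raise m f L).symm
      · have : (Nat.beq m m' && Nat.beq f f') = false := by
          rw [Bool.eq_false_iff]
          simpa using h
        rw [this]
        exact .refl _

theorem rowsEquiv_raiseFlags (L : List (ℕ × ℕ)) : RowsEquiv L (raiseFlags L) := by
  induction L with
  | nil => exact .refl _
  | cons p L ih =>
    obtain ⟨m, f⟩ := p
    rcases L with _ | ⟨⟨m', f'⟩, L⟩
    · exact .refl _
    · refine RowsEquiv.trans ?_ (ih.cons _)
      by_cases h : m = m' ∧ f + 1 = f'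
      · obtain ⟨rfl, rfl⟩ := h
        simpa using rowsEquiv_raise m f L
      · have : (Nat.beq m m' && Nat.beq (f + 1) f') = false := by
          rw [Bool.eq_false_iff]
          simpa using h
        rw [this]
        exact .refl _

/-- Does some row have the flag `f`? -/
def hasFlag (f : ℕ) : List (ℕ × ℕ) → Bool
  | [] => false
  | (_, g) :: L => Nat.beq g f || hasFlag f L

/-- Diminish the part and increase the flag in the row with the flag `a + 1`, if there is exactly
one such row. -/
def passRow (a : ℕ) : List (ℕ × ℕ) → Option (List (ℕ × ℕ))
  | [] => none
  | (m, f) :: L =>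
    bif Nat.beq f (a + 1) then
      match m with
      | 0 => none
      | m + 1 => bif hasFlag (a + 1) L then none else some ((m, a + 2) :: L)
    else (passRow a L).map ((m, f) :: ·)

theorem hasFlag_eq_false {f : ℕ} {L : List (ℕ × ℕ)} (h : hasFlag f L = false) :
    ∀ p ∈ L, p.2 ≠ f := by
  induction L with
  | nil => simp
  | cons q L ih =>
    obtain ⟨m, g⟩ := q
    simp only [hasFlag, Bool.or_eq_false_iff] at h
    intro p hp
    rcases List.mem_cons.1 hp with rfl | hp
    · exact Nat.ne_of_beq_eq_false h.1
    · exact ih h.2 p hp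

theorem passRow_eq_some {a : ℕ} {L L' : List (ℕ × ℕ)} (h : passRow a L = some L') :
    ∃ L₁ m L₂, L = L₁ ++ (m + 1, a + 1) :: L₂ ∧ L' = L₁ ++ (m, a + 2) :: L₂ ∧
      (∀ p ∈ L₁, p.2 ≠ a + 1) ∧ ∀ p ∈ L₂, p.2 ≠ a + 1 := by
  induction L generalizing L' with
  | nil => simp [passRow] at h
  | cons q L ih =>
    obtain ⟨m, f⟩ := q
    by_cases hf : f = a + 1
    · subst hf
      rcases m with _ | m
      · simp [passRow] at h
      · by_cases hL : hasFlag (a + 1) L = true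
        · simp [passRow, hL] at h
        · rw [Bool.not_eq_true] at hL
          simp only [passRow, Nat.beq_refl, cond_true, hL, cond_false, Option.some.injEq] at h
          exact ⟨[], m, L, rfl, h.symm, by simp, hasFlag_eq_false hL⟩
    · have : Nat.beq f (a + 1) = false := by rw [Bool.eq_false_iff]; simpa using hf
      simp only [passRow, this, cond_false, Option.map_eq_some_iff] at h
      obtain ⟨L'', h1, rfl⟩ := h
      obtain ⟨L₁, m', L₂, rfl, rfl, h2, h3⟩ := ih h1
      exact ⟨(m, f) :: L₁, m', L₂, rfl, rfl, by
        intro p hp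
        rcases List.mem_cons.1 hp with rfl | hp
        · exact hf
        · exact h2 p hp, h3⟩

open MvPolynomial in
/-- If the Schubert polynomial of `w` is a flagged determinant, so is that of `w sₐ`. -/
theorem schubertValue_eq_flagPoly_step {n a : ℕ} (ha : a + 1 < n) {w : ℕ → ℕ}
    (hw : w (a + 1) < w a) {L L' : List (ℕ × ℕ)} (h : schubertValue n X w = flagPoly L)
    (hL : passRow a L = some L') :
    schubertValue n X (w ∘ Equiv.swap a (a + 1)) = flagPoly L' := by
  obtain ⟨L₁, m, L₂, rfl, rfl, h1, h2⟩ := passRow_eq_some hL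
  have hX : (rename (Equiv.swap a (a + 1)) : MvPolynomial ℕ ℤ →ₐ[ℤ] _).toRingHom ∘ X =
      X ∘ Equiv.swap a (a + 1) := by
    funext i; simp
  have d1 := schubertValue_divided_difference ha (X (R := ℤ)) w
  have d2 := det_flagMatrix_divided_difference (X (R := ℤ)) (a := a) (m := m) (k := L₁.length)
    (r := (L₁ ++ (m + 1, a + 1) :: L₂).length)
    (l := fun i => (L₁ ++ (m + 1, a + 1) :: L₂).getD i (0, 0)) (by simp) (by simp)
    (by
      intro i hi hik
      rcases hik.lt_or_gt with hlt | hgt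
      · rw [List.getD_append _ _ _ _ hlt, List.getD_eq_getElem _ _ hlt]
        exact h1 _ (List.getElem_mem hlt)
      · obtain ⟨j, rfl⟩ : ∃ j, i = L₁.length + (j + 1) := ⟨i - L₁.length - 1, by omega⟩
        have hj : j < L₂.length := by simp at hi; omega
        rw [List.getD_append_right _ _ _ _ (by omega), show L₁.length + (j + 1) - L₁.length = j + 1
          by omega, List.getD_cons_succ, List.getD_eq_getElem _ _ hj]
        exact h2 _ (List.getElem_mem hj))
  have e1 := schubertValue_map (rename (Equiv.swap a (a + 1)) : MvPolynomial ℕ ℤ →ₐ[ℤ] _).toRingHom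
    n X w
  rw [h, flagPoly, det_flagMatrix_map, hX] at e1
  rw [if_pos hw, ← e1, h, flagPoly, ← d2, ← getD_append_cons] at d1
  have hne : (X a - X (a + 1) : MvPolynomial ℕ ℤ) ≠ 0 :=
    sub_ne_zero.2 fun e => by have := X_injective (R := ℤ) e; omega
  have := mul_left_cancel₀ hne d1
  rw [this]
  exact (flagPoly_eq_det (by simp)).symm

/-- The permutation with a given one-line notation, extended by fixed points. -/
def ofList (l : List ℕ) (i : ℕ) : ℕ := l.getD i i

/-- Exchange the entries at the positions `a` and `a + 1`. -/
def swapAt : ℕ → List ℕ → List ℕ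
  | 0, x :: y :: l => y :: x :: l
  | a + 1, x :: l => x :: swapAt a l
  | _, l => l

/-- Is there a descent at position `a`? -/
def hasDescent : ℕ → List ℕ → Bool
  | 0, x :: y :: _ => Nat.blt y x
  | a + 1, _ :: l => hasDescent a l
  | _, _ => false

theorem length_swapAt (a : ℕ) (l : List ℕ) : (swapAt a l).length = l.length := by
  induction a generalizing l with
  | zero => rcases l with _ | ⟨x, _ | ⟨y, l⟩⟩ <;> simp [swapAt]
  | succ a ih => rcases l with _ | ⟨x, l⟩ <;> simp [swapAt, ih]

theorem getElem?_swapAt {a : ℕ} {l : List ℕ} (h : a + 1 < l.length) (i : ℕ) :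
    (swapAt a l)[i]? = l[Equiv.swap a (a + 1) i]? := by
  induction a generalizing l i with
  | zero =>
    rcases l with _ | ⟨x, _ | ⟨y, l⟩⟩
    · simp at h
    · simp at h
    · rcases i with _ | _ | i
      · simp [swapAt]
      · simp [swapAt]
      · rw [Equiv.swap_apply_of_ne_of_ne (by omega) (by omega)]
        simp [swapAt]
  | succ a ih =>
    rcases l with _ | ⟨x, l⟩
    · simp at h
    · rcases i with _ | i
      · rw [Equiv.swap_apply_of_ne_of_ne (by omega) (by omega)]
        simp [swapAt]
      · have : Equiv.swap (a + 1) (a + 1 + 1) (i + 1) = Equiv.swap a (a + 1) i + 1 := by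
          simp only [Equiv.swap_apply_def]
          split_ifs <;> omega
        rw [this]
        simpa [swapAt] using ih (by simpa using h) i

theorem ofList_swapAt {a : ℕ} {l : List ℕ} (h : a + 1 < l.length) :
    ofList (swapAt a l) = ofList l ∘ Equiv.swap a (a + 1) := by
  funext i
  simp only [ofList, Function.comp, List.getD_eq_getElem?_getD, getElem?_swapAt h]
  by_cases hi : i = a ∨ i = a + 1
  · have : Equiv.swap a (a + 1) i < l.length := by
      rcases hi with rfl | rfl <;> simp <;> omega
    simp [this]
  · rw [Equiv.swap_apply_of_ne_of_ne (by omega) (by omega)]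

theorem hasDescent_iff {a : ℕ} {l : List ℕ} (h : hasDescent a l = true) :
    a + 1 < l.length ∧ ofList l (a + 1) < ofList l a := by
  have key : a + 1 < l.length ∧ ∀ d e, l.getD (a + 1) d < l.getD a e := by
    induction a generalizing l with
    | zero =>
      rcases l with _ | ⟨x, _ | ⟨y, l⟩⟩
      · simp [hasDescent] at h
      · simp [hasDescent] at h
      · simpa [hasDescent, Nat.blt_eq] using h
    | succ a ih =>
      rcases l with _ | ⟨x, l⟩
      · simp [hasDescent] at h
      · simpa using ih (by simpa [hasDescent] using h)
  exact ⟨key.1, key.2 _ _⟩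

/-- One step of the derivation of a determinantal formula, along the letter `a`. If no row can be
chosen, other forms of the determinant are tried. -/
def flagStep (L : List (ℕ × ℕ)) (a : ℕ) : Option (List (ℕ × ℕ)) :=
  match passRow a L with
  | some L' => some (lowerFlags^[2] L')
  | none => (passRow a (raiseFlags^[8] L)).map lowerFlags^[8]

/-- Apply the letters of a word to a permutation in one-line notation, keeping track of a
determinantal formula for its Schubert polynomial. -/
def flagRun : List ℕ → List ℕ → List (ℕ × ℕ) → Option (List ℕ × List (ℕ × ℕ))
  | [], w, L => some (w, L)
  | a :: as, w, L =>
    bif hasDescent a w then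
      match flagStep L a with
      | some L' => flagRun as (swapAt a w) L'
      | none => none
    else none

open MvPolynomial in
theorem schubertValue_eq_flagPoly_run {n : ℕ} {as w w' : List ℕ} {L L' : List (ℕ × ℕ)}
    (hn : w.length = n) (h : schubertValue n X (ofList w) = flagPoly L)
    (hr : flagRun as w L = some (w', L')) : schubertValue n X (ofList w') = flagPoly L' := by
  induction as generalizing w L with
  | nil =>
    simp only [flagRun, Option.some.injEq, Prod.mk.injEq] at hr
    rw [← hr.1, ← hr.2, h]
  | cons a as ih =>
    by_cases hd : hasDescent a w = true
    · rw [flagRun, hd, cond_true] at hr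
      obtain ⟨h1, h2⟩ := hasDescent_iff hd
      cases hs : flagStep L a with
      | none => simp [hs] at hr
      | some L₁ =>
        rw [hs] at hr
        refine ih (by rw [length_swapAt, hn]) ?_ hr
        rw [ofList_swapAt h1]
        cases hp : passRow a L with
        | some L₂ =>
          simp only [flagStep, hp, Option.some.injEq] at hs
          rw [schubertValue_eq_flagPoly_step (by omega) h2 h hp, ← hs]
          exact (RowsEquiv.iterate rowsEquiv_lowerFlags 2 L₂).flagPoly_eq
        | none =>
          simp only [flagStep, hp, Option.map_eq_some_iff] at hs
          obtain ⟨L₂, h3, rfl⟩ := hs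
          rw [(RowsEquiv.iterate rowsEquiv_raiseFlags 8 L).flagPoly_eq] at h
          rw [schubertValue_eq_flagPoly_step (by omega) h2 h h3]
          exact (RowsEquiv.iterate rowsEquiv_lowerFlags 8 L₂).flagPoly_eq
    · simp [flagRun, hd] at hr

/-- The rows of the flagged determinant of the longest permutation. -/
def staircaseRows (n : ℕ) : List (ℕ × ℕ) := (List.range n).map fun i => (n - 1 - i, i + 1)

theorem ofList_reverse_range (n : ℕ) : ofList (List.range n).reverse = reversal n := by
  funext i
  by_cases hi : i < n
  · simp [ofList, reversal, hi]
  · simp [ofList, reversal, hi]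

open MvPolynomial in
theorem schubertValue_reversal_eq_flagPoly (n : ℕ) :
    schubertValue n X (ofList (List.range n).reverse) = flagPoly (staircaseRows n) := by
  have hl : (staircaseRows n).length = n := by simp [staircaseRows]
  rw [ofList_reverse_range, schubertValue_reversal, ← det_flagMatrix_staircase, flagPoly, hl]
  refine congrArg _ (flagMatrix_congr _ fun i hi => ?_)
  simp [staircaseRows, hi]

/-! ### Evaluation of determinants -/

/-- Subtract a multiple of the row `p :: ps` to clear the first entry of another row. -/
def clearFirst (p : ℚ) (ps : List ℚ) : List ℚ → List ℚ
  | c :: cs => let q := c / p; List.zipWith (fun a b => a - q * b) cs ps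
  | [] => []

/-- The determinant of an `n × n` matrix by Gaussian elimination, if no pivot vanishes. -/
def gauss : ℕ → List (List ℚ) → Option ℚ
  | 0, _ => some 1
  | n + 1, (p :: ps) :: M =>
    if p = 0 then none else (gauss n (M.map (clearFirst p ps))).map (p * ·)
  | _, _ => none

/-- The matrix with the given rows. -/
def matrixOfRows (n : ℕ) (M : List (List ℚ)) : Matrix (Fin n) (Fin n) ℚ :=
  .of fun i j => (M.getD i []).getD j 0

theorem det_matrixOfRows {n : ℕ} {M : List (List ℚ)} {d : ℚ} (hM : M.length = n)
    (hrow : ∀ r ∈ M, r.length = n) (h : gauss n M = some d) : (matrixOfRows n M).det = d := by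
  induction n generalizing M d with
  | zero => simpa [gauss] using h
  | succ n ih =>
    rcases M with _ | ⟨_ | ⟨p, ps⟩, M⟩
    · simp at hM
    · simp at hrow
    by_cases hp : p = 0
    · simp [gauss, hp] at h
    simp only [gauss, hp, if_false, Option.map_eq_some_iff] at h
    obtain ⟨d', h1, rfl⟩ := h
    have hps : ps.length = n := by simpa using hrow (p :: ps) (by simp)
    have hM' : M.length = n := by simpa using hM
    have hlen : ∀ r ∈ M, ∃ c cs, r = c :: cs ∧ cs.length = n := by
      intro r hr
      have := hrow r (by simp [hr])
      rcases r with _ | ⟨c, cs⟩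
      · simp at this
      · exact ⟨c, cs, rfl, by simpa using this⟩
    have h2 := ih (M := M.map (clearFirst p ps)) (by simpa using hM') (by
      intro r hr
      obtain ⟨r', hr', rfl⟩ := List.mem_map.1 hr
      obtain ⟨c, cs, rfl, hc⟩ := hlen r' hr'
      simp [clearFirst, hc, hps]) h1
    let B : Matrix (Fin (n + 1)) (Fin (n + 1)) ℚ := .of fun i j =>
      Fin.cases ((p :: ps).getD j 0)
        (fun i => Fin.cases 0 (fun j => matrixOfRows n (M.map (clearFirst p ps)) i j) j) i
    have hB : (matrixOfRows (n + 1) ((p :: ps) :: M)).det = B.det := by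
      refine Matrix.det_eq_of_forall_row_eq_smul_add_const
        (fun i => Fin.cases 0 (fun i => (M.getD i []).getD 0 0 / p) i) 0 rfl fun i j => ?_
      refine Fin.cases ?_ (fun i => ?_) i
      · simp [matrixOfRows, B]
      · have hi : (i : ℕ) < M.length := by omega
        obtain ⟨c, cs, hr, hc⟩ := hlen _ (List.getElem_mem hi)
        refine Fin.cases ?_ (fun j => ?_) j
        · simp [matrixOfRows, B, hi, hr, hp]
        · have hj : (j : ℕ) < cs.length := by omega
          have hj' : (j : ℕ) < ps.length := by omega
          simp [matrixOfRows, B, hi, hr, clearFirst, hj, hj']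
    rw [hB, Matrix.det_succ_column_zero, Fin.sum_univ_succ, ← h2]
    have h3 : B.submatrix (Fin.succAbove 0) Fin.succ =
        matrixOfRows n (M.map (clearFirst p ps)) := by
      ext i j
      simp [B]
    rw [h3]
    simp [B]

/-- The value at `1` of the complete homogeneous polynomial of degree `k` in `f` variables. -/
def multichoose (f k : ℕ) : ℕ := (f + k - 1).descFactorial k / k.factorial

/-- The rows from index `i` on of a flagged determinant with `r` columns, evaluated at `1`. -/
def numericRows (r : ℕ) : ℕ → List (ℕ × ℕ) → List (List ℚ)
  | _, [] => []
  | i, (m, f) :: L =>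
    ((List.range r).map fun j =>
      bif Nat.blt (m + j) i then (0 : ℚ) else (multichoose f (m + j - i) : ℚ)) ::
        numericRows r (i + 1) L

theorem length_numericRows (r i : ℕ) (L : List (ℕ × ℕ)) :
    (numericRows r i L).length = L.length := by
  induction L generalizing i with
  | nil => rfl
  | cons p L ih => simp [numericRows, ih]

theorem length_of_mem_numericRows {r i : ℕ} {L : List (ℕ × ℕ)} {s : List ℚ}
    (h : s ∈ numericRows r i L) : s.length = r := by
  induction L generalizing i with
  | nil => simp [numericRows] at h
  | cons p L ih =>
    rcases List.mem_cons.1 h with rfl | h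
    · simp
    · exact ih h

theorem numericRows_getD {r i k j : ℕ} {L : List (ℕ × ℕ)} (hk : k < L.length) (hj : j < r) :
    ((numericRows r i L).getD k []).getD j 0 =
      completeHomInt (fun _ => (1 : ℚ)) (L.getD k (0, 0)).2
        ((L.getD k (0, 0)).1 - ((i + k : ℕ) : ℤ) + j) := by
  induction L generalizing i k with
  | nil => simp at hk
  | cons p L ih =>
    rcases k with _ | k
    · obtain ⟨m, f⟩ := p
      simp only [numericRows, List.getD_cons_zero, add_zero]
      rw [List.getD_eq_getElem _ _ (by simpa using hj)]
      by_cases h : m + j < i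
      · have : Nat.blt (m + j) i = true := by simpa [Nat.blt_eq] using h
        rw [completeHomInt_of_neg _ _ (by omega)]
        simp [this]
      · have : Nat.blt (m + j) i = false := by
          rw [Bool.eq_false_iff]; simpa [Nat.blt_eq] using h
        rw [show (m : ℤ) - i + j = ((m + j - i : ℕ) : ℤ) by omega, completeHomInt_natCast,
          completeHom_one, Nat.choose_eq_descFactorial_div_factorial]
        simp [this, multichoose]
    · rw [numericRows, List.getD_cons_succ, List.getD_cons_succ, ih (by simpa using hk),
        add_right_comm i 1 k, add_assoc i k 1]

/-- The value at `1` of the Schubert polynomial reached from the longest permutation along a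
word, by a determinantal formula. -/
def wordValue (n : ℕ) (as : List ℕ) : Option (List ℕ × ℚ) :=
  match flagRun as (List.range n).reverse (lowerFlags (staircaseRows n)) with
  | some (w, L) => (gauss L.length (numericRows L.length 0 L)).map (w, ·)
  | none => none

theorem schubertValue_eq_of_wordValue {n : ℕ} {as w : List ℕ} {q : ℚ}
    (h : wordValue n as = some (w, q)) : schubertValue n (fun _ => (1 : ℚ)) (ofList w) = q := by
  rw [wordValue] at h
  cases hr : flagRun as (List.range n).reverse (lowerFlags (staircaseRows n)) with
  | none => simp [hr] at h
  | some wL =>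
    obtain ⟨w', L⟩ := wL
    simp only [hr, Option.map_eq_some_iff, Prod.mk.injEq, exists_eq_right_right] at h
    obtain ⟨hg, rfl⟩ := h
    have h1 := schubertValue_eq_flagPoly_run (n := n) (by simp)
      ((schubertValue_reversal_eq_flagPoly n).trans (rowsEquiv_lowerFlags _).flagPoly_eq) hr
    let φ : MvPolynomial ℕ ℤ →+* ℚ := MvPolynomial.eval₂Hom (Int.castRingHom ℚ) fun _ => 1
    have hφ : φ ∘ MvPolynomial.X = fun _ => 1 := by
      funext i; simp [φ]
    have h2 := congrArg φ h1
    rw [schubertValue_map, hφ, flagPoly, det_flagMatrix_map, hφ] at h2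
    rw [h2, ← det_matrixOfRows (length_numericRows _ _ _)
      (fun s hs => length_of_mem_numericRows hs) hg]
    congr 1
    ext i j
    simp only [flagMatrix, matrixOfRows, Matrix.of_apply]
    rw [numericRows_getD i.2 j.2, zero_add]

/-! ### Monk's rule -/

section Monk

variable {R S : Type*} [CommRing R] [CommRing S]

/-- Exchanging the entries at the positions `a < b` adds exactly one inversion. -/
def IsCover (w : ℕ → ℕ) (a b : ℕ) : Prop :=
  w a < w b ∧ ∀ j, a < j → j < b → ¬ (w a < w j ∧ w j < w b)

theorem swap_lt_swap {a b i : ℕ} (hab : a < b) (h : ¬ (a = i ∧ b = i + 1)) :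
    Equiv.swap i (i + 1) a < Equiv.swap i (i + 1) b := by
  simp only [Equiv.swap_apply_def]
  split_ifs <;> omega

theorem comp_swap_comp_swap (w : ℕ → ℕ) (a b i j : ℕ) :
    (w ∘ Equiv.swap a b) ∘ Equiv.swap i j =
      (w ∘ Equiv.swap i j) ∘ Equiv.swap (Equiv.swap i j a) (Equiv.swap i j b) := by
  funext k
  have h : Equiv.swap a b * Equiv.swap i j =
      Equiv.swap i j * Equiv.swap (Equiv.swap i j a) (Equiv.swap i j b) := by
    rw [Equiv.mul_swap_eq_swap_mul (Equiv.swap i j), Equiv.swap_apply_self, Equiv.swap_apply_self]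
  exact congrArg w (congrArg (fun e : Equiv.Perm ℕ => e k) h)

theorem isCover_swap_iff {w : ℕ → ℕ} (hw : Function.Injective w) {a b i : ℕ} (hab : a < b)
    (h : ¬ (a = i ∧ b = i + 1)) :
    (IsCover w a b ∧ (w ∘ Equiv.swap a b) (i + 1) < (w ∘ Equiv.swap a b) i) ↔
      w (i + 1) < w i ∧
        IsCover (w ∘ Equiv.swap i (i + 1)) (Equiv.swap i (i + 1) a) (Equiv.swap i (i + 1) b) := by
  have key : IsCover (w ∘ Equiv.swap i (i + 1)) (Equiv.swap i (i + 1) a) (Equiv.swap i (i + 1) b) ↔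
      w a < w b ∧ ∀ j, Equiv.swap i (i + 1) a < Equiv.swap i (i + 1) j →
        Equiv.swap i (i + 1) j < Equiv.swap i (i + 1) b → ¬ (w a < w j ∧ w j < w b) := by
    simp only [IsCover, Function.comp, Equiv.swap_apply_self]
    refine and_congr_right fun _ => ⟨fun H j => ?_, fun H j => ?_⟩
    · simpa using H (Equiv.swap i (i + 1) j)
    · simpa using H (Equiv.swap i (i + 1) j)
  have hi : w i ≠ w (i + 1) := fun e => by have := hw e; omega
  have ha : a ≠ i → w a ≠ w i := fun e e' => e (hw e')
  have ha' : a ≠ i + 1 → w a ≠ w (i + 1) := fun e e' => e (hw e')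
  have hb : b ≠ i → w b ≠ w i := fun e e' => e (hw e')
  have hb' : b ≠ i + 1 → w b ≠ w (i + 1) := fun e e' => e (hw e')
  rw [key]
  simp only [IsCover, Function.comp]
  constructor
  · rintro ⟨⟨h1, h2⟩, h3⟩
    have h4 := h2 i
    have h5 := h2 (i + 1)
    refine ⟨?_, h1, fun j => ?_⟩
    · simp only [Equiv.swap_apply_def] at h3
      grind
    · have h6 := h2 j
      simp only [Equiv.swap_apply_def] at h3 ⊢
      grind
  · rintro ⟨h3, h1, h2⟩
    have h4 := h2 i
    have h5 := h2 (i + 1)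
    simp only [Equiv.swap_apply_def] at h4 h5
    refine ⟨⟨h1, fun j => ?_⟩, ?_⟩
    · have h6 := h2 j
      simp only [Equiv.swap_apply_def] at h6
      grind
    · simp only [Equiv.swap_apply_def]
      grind

open Classical in
/-- The contribution of the transposition of the positions `r` and `k` to Monk's rule for
`x r`. -/
noncomputable def monkTerm (n : ℕ) (x : ℕ → R) (w : ℕ → ℕ) (r k : ℕ) : R :=
  (if r < k ∧ IsCover w r k then schubertValue n x (w ∘ Equiv.swap r k) else 0) -
    (if k < r ∧ IsCover w k r then schubertValue n x (w ∘ Equiv.swap k r) else 0)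

theorem monkTerm_antisymm (n : ℕ) (x : ℕ → R) (w : ℕ → ℕ) (r k : ℕ) :
    monkTerm n x w k r = -monkTerm n x w r k := by
  simp [monkTerm]

theorem monkTerm_of_lt {n r k : ℕ} (x : ℕ → R) {w : ℕ → ℕ} (h : r < k) (hc : IsCover w r k) :
    monkTerm n x w r k = schubertValue n x (w ∘ Equiv.swap r k) := by
  simp [monkTerm, h, hc, h.le]

theorem monkTerm_of_lt_of_not {n r k : ℕ} (x : ℕ → R) {w : ℕ → ℕ} (h : r < k)
    (hc : ¬ IsCover w r k) : monkTerm n x w r k = 0 := by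
  simp [monkTerm, hc, h.le]

theorem monkTerm_map (φ : R →+* S) (n : ℕ) (x : ℕ → R) (w : ℕ → ℕ) (r k : ℕ) :
    φ (monkTerm n x w r k) = monkTerm n (φ ∘ x) w r k := by
  simp only [monkTerm, map_sub, apply_ite φ, schubertValue_map, map_zero]

theorem monkTerm_congr {n : ℕ} {x y : ℕ → R} (h : ∀ j, j + 1 < n → x j = y j) (w : ℕ → ℕ)
    (r k : ℕ) : monkTerm n x w r k = monkTerm n y w r k := by
  simp only [monkTerm, schubertValue_congr h]

/-- The divided difference of a term of Monk's rule. -/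
theorem monkTerm_divided_difference {n i : ℕ} (hi : i + 1 < n) (x : ℕ → R) {w : ℕ → ℕ}
    (hw : Function.Injective w) {r k : ℕ} (hrk : r ≠ k) :
    monkTerm n x w r k - monkTerm n (x ∘ Equiv.swap i (i + 1)) w r k =
      (x i - x (i + 1)) * ((if w (i + 1) < w i then monkTerm n x (w ∘ Equiv.swap i (i + 1))
          (Equiv.swap i (i + 1) r) (Equiv.swap i (i + 1) k) else 0) +
        ((if r = i ∧ k = i + 1 then schubertValue n x w else 0) -
          if k = i ∧ r = i + 1 then schubertValue n x w else 0)) := by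
  -- both sides are antisymmetric in `r` and `k`
  wlog h : r < k generalizing r k
  · have := this hrk.symm (by omega)
    rw [monkTerm_antisymm n x w k r, monkTerm_antisymm n _ w k r,
      monkTerm_antisymm n x _ (Equiv.swap i (i + 1) k)]
    rw [← neg_inj]
    rw [show -(-monkTerm n x w k r - -monkTerm n (x ∘ Equiv.swap i (i + 1)) w k r) =
      monkTerm n x w k r - monkTerm n (x ∘ Equiv.swap i (i + 1)) w k r by ring, this]
    split_ifs <;> ring
  by_cases hrk' : r = i ∧ k = i + 1
  · obtain ⟨rfl, rfl⟩ := hrk'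
    have hc : ∀ v : ℕ → ℕ, IsCover v r (r + 1) ↔ v r < v (r + 1) := fun v =>
      ⟨fun h => h.1, fun h => ⟨h, fun j h1 h2 => by omega⟩⟩
    have hne : w r ≠ w (r + 1) := fun e => by have := hw e; omega
    have hss : (w ∘ Equiv.swap r (r + 1)) ∘ Equiv.swap r (r + 1) = w := by
      funext j; simp
    by_cases hd : w (r + 1) < w r
    · have hc' : IsCover (w ∘ Equiv.swap r (r + 1)) r (r + 1) := (hc _).2 (by simpa using hd)
      rw [monkTerm_of_lt_of_not _ h fun e => by have := e.1; omega,
        monkTerm_of_lt_of_not _ h fun e => by have := e.1; omega, if_pos hd,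
        Equiv.swap_apply_left, Equiv.swap_apply_right, monkTerm_antisymm, monkTerm_of_lt _ h hc',
        hss]
      simp
    · have hc' : IsCover w r (r + 1) := (hc _).2 (by omega)
      have := schubertValue_divided_difference hi x (w ∘ Equiv.swap r (r + 1))
      rw [hss, if_pos (by simp; omega)] at this
      rw [monkTerm_of_lt _ h hc', monkTerm_of_lt _ h hc', ← this, if_neg hd]
      simp
  · have h' := swap_lt_swap h hrk'
    rw [if_neg hrk', if_neg (show ¬ (k = i ∧ r = i + 1) by omega), sub_zero, add_zero]
    have key := isCover_swap_iff hw h hrk'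
    by_cases hc : IsCover w r k
    · rw [monkTerm_of_lt _ h hc, monkTerm_of_lt _ h hc, ← schubertValue_divided_difference hi]
      congr 1
      by_cases hd : (w ∘ Equiv.swap r k) (i + 1) < (w ∘ Equiv.swap r k) i
      · obtain ⟨h1, h2⟩ := key.1 ⟨hc, hd⟩
        rw [if_pos hd, if_pos h1, monkTerm_of_lt _ h' h2, comp_swap_comp_swap]
      · rw [if_neg hd]
        by_cases h1 : w (i + 1) < w i
        · rw [if_pos h1, monkTerm_of_lt_of_not _ h' fun h2 => hd (key.2 ⟨h1, h2⟩).2]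
        · rw [if_neg h1]
    · rw [monkTerm_of_lt_of_not _ h hc, monkTerm_of_lt_of_not _ h hc, sub_zero]
      by_cases h1 : w (i + 1) < w i
      · rw [if_pos h1, monkTerm_of_lt_of_not _ h' fun h2 => hc (key.2 ⟨h1, h2⟩).1, mul_zero]
      · rw [if_neg h1, mul_zero]

/-- The difference of the two sides of Monk's rule. -/
noncomputable def monkError (n : ℕ) (x : ℕ → R) (w : ℕ → ℕ) (r : ℕ) : R :=
  x r * schubertValue n x w - ∑ k ∈ Finset.range n, monkTerm n x w r k

theorem monkError_map (φ : R →+* S) (n : ℕ) (x : ℕ → R) (w : ℕ → ℕ) (r : ℕ) :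
    φ (monkError n x w r) = monkError n (φ ∘ x) w r := by
  simp only [monkError, map_sub, map_mul, schubertValue_map, map_sum, monkTerm_map, Function.comp]

theorem monkError_congr {n r : ℕ} (hr : r + 1 < n) {x y : ℕ → R}
    (h : ∀ j, j + 1 < n → x j = y j) (w : ℕ → ℕ) : monkError n x w r = monkError n y w r := by
  simp only [monkError, schubertValue_congr h, monkTerm_congr h, h r hr]

theorem monkTerm_self (n : ℕ) (x : ℕ → R) (w : ℕ → ℕ) (r : ℕ) : monkTerm n x w r r = 0 := by
  simp [monkTerm]

theorem monkError_divided_difference {n i r : ℕ} (hi : i + 1 < n) (hr : r < n) (x : ℕ → R)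
    {w : ℕ → ℕ} (hw : Function.Injective w) :
    monkError n x w r - monkError n (x ∘ Equiv.swap i (i + 1)) w r =
      (x i - x (i + 1)) * if w (i + 1) < w i then
        monkError n x (w ∘ Equiv.swap i (i + 1)) (Equiv.swap i (i + 1) r) else 0 := by
  have h1 : ∑ k ∈ Finset.range n, monkTerm n x w r k -
      ∑ k ∈ Finset.range n, monkTerm n (x ∘ Equiv.swap i (i + 1)) w r k =
      (x i - x (i + 1)) * ((if w (i + 1) < w i then ∑ k ∈ Finset.range n,
        monkTerm n x (w ∘ Equiv.swap i (i + 1)) (Equiv.swap i (i + 1) r) k else 0) +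
        ((if r = i then schubertValue n x w else 0) -
          if r = i + 1 then schubertValue n x w else 0)) := by
    have e1 : ∑ k ∈ Finset.range n,
          monkTerm n x (w ∘ Equiv.swap i (i + 1)) (Equiv.swap i (i + 1) r) k =
        ∑ k ∈ Finset.range n, monkTerm n x (w ∘ Equiv.swap i (i + 1))
          (Equiv.swap i (i + 1) r) (Equiv.swap i (i + 1) k) := by
      refine (Finset.sum_equiv (Equiv.swap i (i + 1)) (fun k => ?_) fun k _ => rfl).symm
      simp only [Finset.mem_range, Equiv.swap_apply_def]
      split_ifs <;> omega
    have e2 : (if r = i then schubertValue n x w else 0) = ∑ k ∈ Finset.range n,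
        if r = i ∧ k = i + 1 then schubertValue n x w else 0 := by
      by_cases h : r = i <;> simp [h, hi]
    have e3 : (if r = i + 1 then schubertValue n x w else 0) = ∑ k ∈ Finset.range n,
        if k = i ∧ r = i + 1 then schubertValue n x w else 0 := by
      by_cases h : r = i + 1 <;> simp [h, show i < n by omega]
    have e4 : (if w (i + 1) < w i then ∑ k ∈ Finset.range n,
        monkTerm n x (w ∘ Equiv.swap i (i + 1)) (Equiv.swap i (i + 1) r) k else 0) =
        ∑ k ∈ Finset.range n, if w (i + 1) < w i then monkTerm n x (w ∘ Equiv.swap i (i + 1))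
          (Equiv.swap i (i + 1) r) (Equiv.swap i (i + 1) k) else 0 := by
      by_cases h : w (i + 1) < w i <;> simp [h, e1]
    rw [e2, e3, e4, ← Finset.sum_sub_distrib, ← Finset.sum_sub_distrib, ← Finset.sum_add_distrib,
      Finset.mul_sum]
    refine Finset.sum_congr rfl fun k _ => ?_
    by_cases hk : r = k
    · subst hk
      have : ¬ (r = i ∧ r = i + 1) := by omega
      simp [monkTerm_self, this]
    · exact monkTerm_divided_difference hi x hw hk
  have h2 := schubertValue_divided_difference hi x w
  have h3 : (x r - x (Equiv.swap i (i + 1) r)) * schubertValue n x w = (x i - x (i + 1)) *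
      ((if r = i then schubertValue n x w else 0) -
        if r = i + 1 then schubertValue n x w else 0) := by
    rw [Equiv.swap_apply_def]
    split_ifs with h4 h5 h6
    · omega
    · subst h4; ring
    · subst h6; ring
    · ring
  simp only [monkError, Function.comp] at *
  by_cases hd : w (i + 1) < w i
  · simp only [hd, if_true] at *
    linear_combination (x (Equiv.swap i (i + 1) r)) * (-h2) + h3 - h1
  · simp only [hd, if_false] at *
    linear_combination (x (Equiv.swap i (i + 1) r)) * (-h2) + h3 - h1

theorem nilOne_comp_swap {w : ℕ → ℕ} {a b : ℕ} (hab : a < b) (h : w a < w b) :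
    nilOne R (w ∘ Equiv.swap a b) = 0 := by
  have : w ∘ Equiv.swap a b ≠ id := fun e => by
    have h1 := congrFun e a
    have h2 := congrFun e b
    simp at h1 h2
    omega
  simp [nilOne, this]

theorem monkError_zero (n : ℕ) (w : ℕ → ℕ) (r : ℕ) : monkError n (0 : ℕ → R) w r = 0 := by
  have : ∀ k, monkTerm n (0 : ℕ → R) w r k = 0 := by
    intro k
    simp only [monkTerm, schubertValue_zero]
    have h1 : r < k ∧ IsCover w r k → nilOne R (w ∘ Equiv.swap r k) = 0 :=
      fun h => nilOne_comp_swap h.1 h.2.1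
    have h2 : k < r ∧ IsCover w k r → nilOne R (w ∘ Equiv.swap k r) = 0 :=
      fun h => nilOne_comp_swap h.1 h.2.1
    split_ifs with h3 h4 h4 <;> simp_all
  simp [monkError, this]

/-- A function of the variables before `x (n - 1)` which is symmetric in the first `n` variables
is constant. -/
theorem eq_of_symmetric {A B : Type*} {n : ℕ} {F : (ℕ → A) → B}
    (hF : ∀ x y : ℕ → A, (∀ j, j + 1 < n → x j = y j) → F x = F y)
    (hs : ∀ i, i + 1 < n → ∀ x, F (x ∘ Equiv.swap i (i + 1)) = F x) (x y : ℕ → A) :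
    F x = F y := by
  have key : ∀ d k, k + d + 1 = n → ∀ x y : ℕ → A, (∀ j, j < k → x j = y j) → F x = F y := by
    intro d
    induction d with
    | zero => intro k hk x y h; exact hF x y fun j hj => h j (by omega)
    | succ d ih =>
      intro k hk x y h
      have e1 : F x = F (Function.update x (k + 1) (y k)) :=
        ih (k + 1) (by omega) _ _ fun j hj => by
          rw [Function.update_of_ne (by omega)]
      rw [e1, ← hs k (by omega)]
      refine ih (k + 1) (by omega) _ _ fun j hj => ?_
      rcases (show j = k ∨ j < k by omega) with rfl | hj'
      · simp
      · rw [Function.comp, Equiv.swap_apply_of_ne_of_ne (by omega) (by omega),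
          Function.update_of_ne (by omega), h j hj']
  rcases n with _ | n
  · exact hF x y fun j hj => by omega
  · exact key n 0 (by omega) x y fun j hj => by omega

open MvPolynomial in
theorem monkError_X_eq_zero {n : ℕ} {w : ℕ → ℕ} (hw : Function.Injective w)
    (hn : ∀ i, n ≤ i + 1 → w i = i) {r : ℕ} (hr : r + 1 < n) :
    monkError n (X : ℕ → MvPolynomial ℕ ℤ) w r = 0 := by
  induction hμ : ∑ i ∈ Finset.range n, (n - i) * w i using Nat.strong_induction_on
    generalizing w r with
  | _ μ ih =>
    have hs : ∀ i, i + 1 < n → monkError n (X ∘ Equiv.swap i (i + 1) : ℕ → MvPolynomial ℕ ℤ) w r =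
        monkError n X w r := by
      intro i hi
      have h := monkError_divided_difference hi (show r < n by omega)
        (X : ℕ → MvPolynomial ℕ ℤ) hw
      by_cases hd : w (i + 1) < w i
      · -- the letter `n - 2` is an ascent, so the other ones preserve the assumptions
        have hi' : i + 2 < n := by
          by_contra hcon
          have h1 := hn (i + 1) (by omega)
          have h2 := hn (w i) (by omega)
          have := hw h2
          omega
        have h0 : monkError n (X : ℕ → MvPolynomial ℕ ℤ) (w ∘ Equiv.swap i (i + 1))
            (Equiv.swap i (i + 1) r) = 0 := by
          refine ih _ ?_ (hw.comp (Equiv.injective _)) (fun j hj => ?_) ?_ rfl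
          · rw [← hμ]
            have hsub : ({i, i + 1} : Finset ℕ) ⊆ Finset.range n := by
              intro j hj
              simp only [Finset.mem_insert, Finset.mem_singleton] at hj
              simp only [Finset.mem_range]
              omega
            rw [← Finset.sum_sdiff hsub, ← Finset.sum_sdiff hsub (f := fun i => (n - i) * w i)]
            have e : ∑ j ∈ Finset.range n \ {i, i + 1}, (n - j) * (w ∘ Equiv.swap i (i + 1)) j =
                ∑ j ∈ Finset.range n \ {i, i + 1}, (n - j) * w j := by
              refine Finset.sum_congr rfl fun j hj => ?_
              simp only [Finset.mem_sdiff, Finset.mem_insert, Finset.mem_singleton, not_or] at hj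
              simp [Equiv.swap_apply_of_ne_of_ne hj.2.1 hj.2.2]
            rw [e]
            refine Nat.add_lt_add_left ?_ _
            rw [Finset.sum_pair (by omega), Finset.sum_pair (by omega)]
            simp only [Function.comp, Equiv.swap_apply_left, Equiv.swap_apply_right]
            obtain ⟨d, hd'⟩ : ∃ d, n - i = d + 1 := ⟨n - i - 1, by omega⟩
            rw [hd', show n - (i + 1) = d by omega]
            nlinarith
          · rw [Function.comp, Equiv.swap_apply_of_ne_of_ne (by omega) (by omega), hn j hj]
          · rw [Equiv.swap_apply_def]
            split_ifs <;> omega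
        rw [if_pos hd, h0, mul_zero] at h
        exact (sub_eq_zero.1 h).symm
      · rw [if_neg hd, mul_zero] at h
        exact (sub_eq_zero.1 h).symm
    have hs' : ∀ i, i + 1 < n → ∀ x : ℕ → MvPolynomial ℕ ℤ,
        monkError n (x ∘ Equiv.swap i (i + 1)) w r = monkError n x w r := by
      intro i hi x
      have h := congrArg (eval₂Hom (Int.castRingHom (MvPolynomial ℕ ℤ)) x) (hs i hi)
      rw [monkError_map, monkError_map] at h
      have e : (eval₂Hom (Int.castRingHom (MvPolynomial ℕ ℤ)) x) ∘ X = x := by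
        funext j; simp
      rwa [← Function.comp_assoc, e] at h
    rw [eq_of_symmetric (F := fun x => monkError n x w r) (fun x y h => monkError_congr hr h w)
      hs' X 0, monkError_zero]

/-- Monk's rule: the product of a variable and of a Schubert polynomial. -/
theorem mul_schubertValue {n : ℕ} (x : ℕ → R) {w : ℕ → ℕ} (hw : Function.Injective w)
    (hn : ∀ i, n ≤ i + 1 → w i = i) {r : ℕ} (hr : r + 1 < n) :
    x r * schubertValue n x w = ∑ k ∈ Finset.range n, monkTerm n x w r k := by
  have h := congrArg (MvPolynomial.eval₂Hom (Int.castRingHom R) x)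
    (monkError_X_eq_zero hw hn hr)
  have e : (MvPolynomial.eval₂Hom (Int.castRingHom R) x) ∘ MvPolynomial.X = x := by
    funext j; simp
  rw [monkError_map, e, map_zero] at h
  exact sub_eq_zero.1 h

end Monk

/-! ### Pipe dreams and words -/

section PipeDreams

/-- The state reached from `σ` by processing the tiles of the list `ts` from the last one to the
first one. A crossing at the tile `(i, j)` exchanges the pipes at the positions `i + j` and
`i + j + 1`. -/
def runTiles (D : Finset (ℕ × ℕ)) (σ : ℕ → ℕ) : List (ℕ × ℕ) → ℕ → ℕ
  | [] => σ
  | t :: ts =>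
    if t ∈ D then runTiles D σ ts ∘ Equiv.swap (t.1 + t.2) (t.1 + t.2 + 1) else runTiles D σ ts

/-- Whether the pipes are in increasing order before each crossing. -/
def IsAscending (D : Finset (ℕ × ℕ)) : List (ℕ × ℕ) → Prop
  | [] => True
  | t :: ts => IsAscending D ts ∧
      (t ∈ D → runTiles D id ts (t.1 + t.2) < runTiles D id ts (t.1 + t.2 + 1))

/-- The pairs of pipes exchanged when processing a list of tiles. -/
def crossings (D : Finset (ℕ × ℕ)) (σ : ℕ → ℕ) : List (ℕ × ℕ) → List (Sym2 ℕ)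
  | [] => []
  | t :: ts =>
    if t ∈ D then
      s(runTiles D σ ts (t.1 + t.2), runTiles D σ ts (t.1 + t.2 + 1)) :: crossings D σ ts
    else crossings D σ ts

theorem runTiles_append (D : Finset (ℕ × ℕ)) (σ : ℕ → ℕ) (A B : List (ℕ × ℕ)) :
    runTiles D σ (A ++ B) = runTiles D (runTiles D σ B) A := by
  induction A with
  | nil => rfl
  | cons t A ih => simp only [List.cons_append, runTiles, ih]

theorem crossings_append (D : Finset (ℕ × ℕ)) (σ : ℕ → ℕ) (A B : List (ℕ × ℕ)) :
    crossings D σ (A ++ B) = crossings D (runTiles D σ B) A ++ crossings D σ B := by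
  induction A with
  | nil => rfl
  | cons t A ih =>
    simp only [List.cons_append, crossings, runTiles_append, ih]
    split_ifs <;> simp

theorem runTiles_congr {D D' : Finset (ℕ × ℕ)} (σ : ℕ → ℕ) {ts : List (ℕ × ℕ)}
    (h : ∀ t ∈ ts, t ∈ D ↔ t ∈ D') : runTiles D σ ts = runTiles D' σ ts := by
  induction ts with
  | nil => rfl
  | cons t ts ih =>
    simp only [runTiles, ih fun t ht => h t (List.mem_cons_of_mem _ ht), h t List.mem_cons_self]

theorem isAscending_congr {D D' : Finset (ℕ × ℕ)} {ts : List (ℕ × ℕ)}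
    (h : ∀ t ∈ ts, t ∈ D ↔ t ∈ D') : IsAscending D ts ↔ IsAscending D' ts := by
  induction ts with
  | nil => rfl
  | cons t ts ih =>
    have h' : ∀ t ∈ ts, t ∈ D ↔ t ∈ D' := fun t ht => h t (List.mem_cons_of_mem _ ht)
    simp only [IsAscending, ih h', runTiles_congr id h', h t List.mem_cons_self]

theorem runTiles_injective (D : Finset (ℕ × ℕ)) (ts : List (ℕ × ℕ)) :
    Function.Injective (runTiles D id ts) := by
  induction ts with
  | nil => exact Function.injective_id
  | cons t ts ih =>
    simp only [runTiles]
    split_ifs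
    · exact ih.comp (Equiv.injective _)
    · exact ih

theorem runTiles_of_le {n : ℕ} (D : Finset (ℕ × ℕ)) {ts : List (ℕ × ℕ)}
    (h : ∀ t ∈ ts, t.1 + t.2 + 1 < n) {p : ℕ} (hp : n ≤ p) : runTiles D id ts p = p := by
  induction ts with
  | nil => rfl
  | cons t ts ih =>
    have ht := h t List.mem_cons_self
    have := ih fun t ht => h t (List.mem_cons_of_mem _ ht)
    simp only [runTiles]
    split_ifs
    · rw [Function.comp, Equiv.swap_apply_of_ne_of_ne (by omega) (by omega), this]
    · exact this

/-- If the pipes are in increasing order before each crossing, the pairs of pipes which have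
crossed are the inversions of the current state. -/
theorem mem_crossings_iff {D : Finset (ℕ × ℕ)} {ts : List (ℕ × ℕ)} (h : IsAscending D ts) {p q : ℕ}
    (hpq : p < q) :
    s(runTiles D id ts p, runTiles D id ts q) ∈ crossings D id ts ↔
      runTiles D id ts q < runTiles D id ts p := by
  induction ts generalizing p q with
  | nil => simp [crossings, runTiles]; omega
  | cons t ts ih =>
    obtain ⟨h1, h2⟩ := h
    by_cases ht : t ∈ D
    · have h3 := h2 ht
      simp only [crossings, runTiles, ht, if_true, List.mem_cons, Function.comp]
      set a := t.1 + t.2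
      have hinj := runTiles_injective D ts
      by_cases hpa : p = a ∧ q = a + 1
      · obtain ⟨rfl, rfl⟩ := hpa
        simp [Sym2.eq_swap, h3]
      · have h4 := swap_lt_swap hpq hpa
        rw [ih h1 h4, or_iff_right]
        intro e
        rcases Sym2.eq_iff.1 e with ⟨e1, e2⟩ | ⟨e1, e2⟩
        · have e1 := hinj e1
          have e2 := hinj e2
          simp only [Equiv.swap_apply_def] at e1 e2
          split_ifs at e1 e2 <;> omega
        · have e1 := hinj e1
          have e2 := hinj e2
          omega
    · simpa [crossings, runTiles, ht] using ih h1 hpq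

theorem nodup_crossings_iff (D : Finset (ℕ × ℕ)) (ts : List (ℕ × ℕ)) :
    (crossings D id ts).Nodup ↔ IsAscending D ts := by
  induction ts with
  | nil => simp [crossings, IsAscending]
  | cons t ts ih =>
    by_cases ht : t ∈ D
    · simp only [crossings, ht, if_true, List.nodup_cons, ih, IsAscending, true_imp_iff]
      rw [and_comm]
      refine and_congr_right fun h => ?_
      rw [mem_crossings_iff h (Nat.lt_add_one _)]
      have : runTiles D id ts (t.1 + t.2) ≠ runTiles D id ts (t.1 + t.2 + 1) := fun e => by
        have := runTiles_injective D ts e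
        omega
      omega
    · simp [crossings, ht, ih, IsAscending]

open Classical in
/-- The subsets of a list of tiles, processed with increasing crossings only, are counted by the
coefficients of a product in the nilCoxeter algebra. -/
theorem card_isAscending {R : Type*} [CommRing R] {ts : List (ℕ × ℕ)} (hts : ts.Nodup)
    (w : ℕ → ℕ) :
    (((ts.toFinset.powerset.filter fun D => IsAscending D ts ∧ runTiles D id ts = w).card : ℕ) :
        R) =
      (ts.map fun t => factor (nilGen R) (t.1 + t.2) (1 : R)).prod (nilOne R) w := by
  induction ts generalizing w with
  | nil =>
    by_cases h : w = id
    · subst h; simp [IsAscending, runTiles, nilOne, Finset.filter_singleton]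
    · simp [IsAscending, runTiles, nilOne, Finset.filter_singleton, h, Ne.symm h]
  | cons t ts ih =>
    obtain ⟨ht, hts⟩ := List.nodup_cons.1 hts
    have ht' : t ∉ ts.toFinset := by simpa using ht
    rw [List.map_cons, List.prod_cons, Module.End.mul_apply, factor_nilGen_apply, ← ih hts,
      ← ih hts, List.toFinset_cons, Finset.powerset_insert, Finset.filter_union,
      Finset.card_union_of_disjoint]
    · rw [Nat.cast_add, one_mul]
      congr 2
      · congr 1
        refine Finset.filter_congr fun D hD => ?_
        have : t ∉ D := fun h => ht' (Finset.mem_powerset.1 hD h)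
        simp [IsAscending, runTiles, this]
      · set a := t.1 + t.2
        have key : ∀ D ∈ ts.toFinset.powerset,
            ((IsAscending (insert t D) (t :: ts) ∧ runTiles (insert t D) id (t :: ts) = w) ↔
              w (a + 1) < w a ∧ IsAscending D ts ∧
                runTiles D id ts = w ∘ Equiv.swap a (a + 1)) := by
          intro D hD
          have hc : ∀ t' ∈ ts, t' ∈ insert t D ↔ t' ∈ D := fun t' h => by
            have : t' ≠ t := fun e => ht (e ▸ h)
            simp [this]
          simp only [IsAscending, runTiles, Finset.mem_insert_self, if_true, true_imp_iff,
            isAscending_congr hc, runTiles_congr id hc]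
          constructor
          · rintro ⟨⟨h1, h2⟩, rfl⟩
            refine ⟨by simpa [a] using h2, h1, ?_⟩
            funext p
            simp [a]
          · rintro ⟨h1, h2, h3⟩
            refine ⟨⟨h2, by simpa [h3, a] using h1⟩, ?_⟩
            funext p
            simp [h3, a]
        rw [Finset.filter_image, Finset.card_image_of_injOn]
        · by_cases hd : w (a + 1) < w a
          · rw [if_pos hd]
            congr 1
            congr 1
            refine Finset.filter_congr fun D hD => ?_
            rw [key D hD]
            simp [hd]
          · rw [if_neg hd, Finset.filter_eq_empty_iff.2 fun D hD h => hd ((key D hD).1 h).1]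
            simp
        · intro D hD D' hD' e
          simp only [Finset.coe_filter, Finset.mem_powerset, Set.mem_ofPred_eq] at hD hD'
          have e1 : t ∉ D := fun h => ht' (hD.1 h)
          have e2 : t ∉ D' := fun h => ht' (hD'.1 h)
          rw [← Finset.erase_insert e1, ← Finset.erase_insert e2]
          exact congrArg (fun E => E.erase t) e
    · rw [Finset.disjoint_left]
      intro D h1 h2
      obtain ⟨E, _, rfl⟩ := Finset.mem_image.1 (Finset.mem_filter.1 h2).1
      exact ht' (Finset.mem_powerset.1 (Finset.mem_filter.1 h1).1 (Finset.mem_insert_self _ _))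

/-- The tiles `(i, j), …, (i + k - 1, j)` of the column `j`. -/
def columnTiles (j : ℕ) : ℕ → ℕ → List (ℕ × ℕ)
  | _, 0 => []
  | i, k + 1 => (i, j) :: columnTiles j (i + 1) k

/-- The tiles of a staircase with columns `j, …, j + k - 1`, of lengths `k, …, 1`. The first
column comes last. -/
def staircaseTiles : ℕ → ℕ → List (ℕ × ℕ)
  | _, 0 => []
  | j, k + 1 => staircaseTiles (j + 1) k ++ columnTiles j 0 (k + 1)

theorem mem_columnTiles {j i k : ℕ} {t : ℕ × ℕ} :
    t ∈ columnTiles j i k ↔ t.2 = j ∧ i ≤ t.1 ∧ t.1 < i + k := by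
  induction k generalizing i with
  | zero => simp [columnTiles]
  | succ k ih =>
    obtain ⟨a, b⟩ := t
    simp only [columnTiles, List.mem_cons, ih, Prod.mk.injEq]
    omega

theorem mem_staircaseTiles {j k : ℕ} {t : ℕ × ℕ} :
    t ∈ staircaseTiles j k ↔ j ≤ t.2 ∧ t.1 + t.2 < j + k := by
  induction k generalizing j with
  | zero => simp [staircaseTiles]; omega
  | succ k ih =>
    simp only [staircaseTiles, List.mem_append, ih, mem_columnTiles]
    omega

theorem nodup_columnTiles (j i k : ℕ) : (columnTiles j i k).Nodup := by
  induction k generalizing i with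
  | zero => exact List.nodup_nil
  | succ k ih =>
    rw [columnTiles, List.nodup_cons, mem_columnTiles]
    exact ⟨by omega, ih (i + 1)⟩

theorem nodup_staircaseTiles (j k : ℕ) : (staircaseTiles j k).Nodup := by
  induction k generalizing j with
  | zero => exact List.nodup_nil
  | succ k ih =>
    rw [staircaseTiles, List.nodup_append']
    refine ⟨ih (j + 1), nodup_columnTiles _ _ _, fun t h1 h2 => ?_⟩
    rw [mem_staircaseTiles] at h1
    rw [mem_columnTiles] at h2
    omega

theorem toFinset_staircaseTiles (n : ℕ) : (staircaseTiles 0 (n - 1)).toFinset = staircase n := by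
  ext t
  simp only [List.mem_toFinset, mem_staircaseTiles, staircase, Finset.mem_filter,
    Finset.mem_product, Finset.mem_range]
  omega

theorem prod_columnTiles {R : Type*} [CommRing R] (j i k : ℕ) :
    ((columnTiles j i k).map fun t => factor (nilGen R) (t.1 + t.2) (1 : R)).prod =
      ladder (nilGen R) (i + j) k (1 : R) := by
  induction k generalizing i with
  | zero => rfl
  | succ k ih => rw [columnTiles, List.map_cons, List.prod_cons, ih, ladder, add_right_comm]

theorem prod_staircaseTiles {R : Type*} [CommRing R] (j k : ℕ) :
    ((staircaseTiles j k).map fun t => factor (nilGen R) (t.1 + t.2) (1 : R)).prod =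
      ladders (nilGen R) j k fun _ => (1 : R) := by
  induction k generalizing j with
  | zero => rfl
  | succ k ih =>
    rw [staircaseTiles, List.map_append, List.prod_append, ih, prod_columnTiles, ladders, zero_add]

/-! ### The labels of the pipes -/

section Labels

variable {n : ℕ} {D : Finset (ℕ × ℕ)}

/-- The label of the pipe on the left edge of the tile `(i, j)`. -/
def sideLabel (n : ℕ) (D : Finset (ℕ × ℕ)) (i j : ℕ) : ℕ := leftLabel D i (topLabel n D (i + 1)) j

theorem sideLabel_zero (n : ℕ) (D : Finset (ℕ × ℕ)) (i : ℕ) : sideLabel n D i 0 = i := by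
  rw [sideLabel, leftLabel]

theorem sideLabel_succ (n : ℕ) (D : Finset (ℕ × ℕ)) (i j : ℕ) :
    sideLabel n D i (j + 1) =
      if (i, j) ∈ D then sideLabel n D i j else topLabel n D (i + 1) j := by
  rw [sideLabel, leftLabel, sideLabel]

theorem topLabel_of_lt (D : Finset (ℕ × ℕ)) {i : ℕ} (hi : i < n) (j : ℕ) :
    topLabel n D i j = if (i, j) ∈ D then topLabel n D (i + 1) j else sideLabel n D i j := by
  rw [topLabel, if_pos hi, sideLabel]

theorem topLabel_of_le (D : Finset (ℕ × ℕ)) {i : ℕ} (hi : n ≤ i) (j : ℕ) :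
    topLabel n D i j = i + j := by
  rw [topLabel, if_neg (by omega)]

/-- Outside of the staircase there are only elbows. -/
theorem topLabel_eq_sideLabel (hD : ∀ t ∈ D, t.1 + t.2 + 1 < n) {i j : ℕ} (h : n ≤ i + j + 1) :
    topLabel n D i j = sideLabel n D i j := by
  have hij : ∀ i j, n ≤ i + j + 1 → (i, j) ∉ D := fun i j h h' => by
    have := hD _ h'
    simp only at this
    omega
  by_cases hi : i < n
  · rw [topLabel_of_lt D hi, if_neg (hij i j h)]
  · rw [topLabel_of_le D (by omega)]
    rcases j with _ | j
    · rw [sideLabel_zero, add_zero]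
    · rw [sideLabel_succ, if_neg (hij i j (by omega)), topLabel_of_le D (by omega)]
      omega

/-- The labels met along the boundary between the columns before `j` and those from `j` on. -/
def columnState (n : ℕ) (D : Finset (ℕ × ℕ)) (j p : ℕ) : ℕ :=
  if p < j then topLabel n D 0 p else sideLabel n D (p - j) j

/-- The labels met along the same boundary when the tiles `(i, j), (i + 1, j), …` of the next
column are added. -/
def partialState (n : ℕ) (D : Finset (ℕ × ℕ)) (i j p : ℕ) : ℕ :=
  if p < j then topLabel n D 0 p else if p < j + i then sideLabel n D (p - j) j
  else if p = j + i then topLabel n D i j else sideLabel n D (p - j - 1) (j + 1)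

theorem partialState_zero (n : ℕ) (D : Finset (ℕ × ℕ)) (j : ℕ) :
    partialState n D 0 j = columnState n D (j + 1) := by
  funext p
  simp only [partialState, columnState, add_zero]
  rcases lt_trichotomy p j with h | rfl | h
  · simp [h, show p < j + 1 by omega]
  · simp
  · simp only [show ¬ p < j by omega, show p ≠ j by omega, show ¬ p < j + 1 by omega, if_false]
    rfl

theorem partialState_last (hD : ∀ t ∈ D, t.1 + t.2 + 1 < n) {i j : ℕ} (h : i + j + 1 = n) :
    partialState n D i j = columnState n D j := by
  funext p
  simp only [partialState, columnState]
  by_cases h1 : p < j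
  · simp [h1]
  by_cases h2 : p < j + i
  · simp [h1, h2]
  by_cases h3 : p = j + i
  · subst h3
    simp [topLabel_eq_sideLabel hD (show n ≤ i + j + 1 by omega)]
  · have h4 : (p - j - 1, j) ∉ D := fun h' => by
      have := hD _ h'
      simp only at this
      omega
    simp only [h1, h2, h3, if_false]
    rw [sideLabel_succ, if_neg h4, show p - j - 1 + 1 = p - j by omega,
      topLabel_eq_sideLabel hD (by omega)]

theorem partialState_left {i j : ℕ} : partialState n D (i + 1) j (i + j) = sideLabel n D i j := by
  simp [partialState, show ¬ i + j < j by omega, show i + j < j + (i + 1) by omega]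

theorem partialState_bottom {i j : ℕ} :
    partialState n D (i + 1) j (i + j + 1) = topLabel n D (i + 1) j := by
  simp [partialState, show i + j + 1 = j + (i + 1) by omega]

theorem partialState_step {i : ℕ} (hi : i < n) (j : ℕ) :
    partialState n D i j = if (i, j) ∈ D then
      partialState n D (i + 1) j ∘ Equiv.swap (i + j) (i + j + 1) else
      partialState n D (i + 1) j := by
  have h0 : ∀ p, p ≠ i + j → p ≠ i + j + 1 →
      partialState n D i j p = partialState n D (i + 1) j p := by
    intro p h1 h2
    simp only [partialState]
    split_ifs <;> first | rfl | omega
  have h1 : partialState n D i j (i + j) = topLabel n D i j := by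
    simp [partialState, show i + j = j + i by omega]
  have h2 : partialState n D i j (i + j + 1) = sideLabel n D i (j + 1) := by
    simp [partialState, show ¬ i + j + 1 < j by omega, show ¬ i + j + 1 < j + i by omega,
      show i + j + 1 ≠ j + i by omega, show i + j + 1 - j - 1 = i by omega]
  funext p
  by_cases hp : p = i + j
  · subst hp
    rw [h1, topLabel_of_lt D hi]
    split_ifs <;> simp [partialState_left, partialState_bottom]
  by_cases hp' : p = i + j + 1
  · subst hp'
    rw [h2, sideLabel_succ]
    split_ifs <;> simp [partialState_left, partialState_bottom]
  rw [h0 p hp hp']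
  split_ifs
  · rw [Function.comp, Equiv.swap_apply_of_ne_of_ne hp hp']
  · rfl

theorem runTiles_columnTiles (hD : ∀ t ∈ D, t.1 + t.2 + 1 < n) {i j k : ℕ} (h : i + k + j + 1 = n) :
    runTiles D (columnState n D j) (columnTiles j i k) = partialState n D i j ∧
      crossings D (columnState n D j) (columnTiles j i k) =
        ((columnTiles j i k).filter (· ∈ D)).map (pipesAt n D) := by
  induction k generalizing i with
  | zero => exact ⟨(partialState_last hD (by omega)).symm, rfl⟩
  | succ k ih =>
    obtain ⟨h1, h2⟩ := ih (i := i + 1) (by omega)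
    refine ⟨?_, ?_⟩
    · simp only [columnTiles, runTiles, h1]
      exact (partialState_step (by omega) j).symm
    · simp only [columnTiles, crossings, h1, h2, List.filter_cons]
      by_cases hm : (i, j) ∈ D
      · simp [hm, partialState_left, partialState_bottom, pipesAt, sideLabel]
      · simp [hm]

theorem runTiles_staircaseTiles (hD : ∀ t ∈ D, t.1 + t.2 + 1 < n) {j k : ℕ} (h : k + j + 1 = n) :
    runTiles D (columnState n D j) (staircaseTiles j k) = columnState n D (j + k) ∧
      crossings D (columnState n D j) (staircaseTiles j k) =
        ((staircaseTiles j k).filter (· ∈ D)).map (pipesAt n D) := by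
  induction k generalizing j with
  | zero => exact ⟨rfl, rfl⟩
  | succ k ih =>
    obtain ⟨h1, h2⟩ := runTiles_columnTiles hD (i := 0) (j := j) (k := k + 1) (by omega)
    obtain ⟨h3, h4⟩ := ih (j := j + 1) (by omega)
    rw [partialState_zero] at h1
    refine ⟨?_, ?_⟩
    · rw [staircaseTiles, runTiles_append, h1, h3]
      congr 1
      omega
    · rw [staircaseTiles, crossings_append, h1, h2, h4, List.filter_append, List.map_append]

theorem columnState_zero (n : ℕ) (D : Finset (ℕ × ℕ)) : columnState n D 0 = id := by
  funext p
  simp [columnState, sideLabel_zero]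

theorem isReduced_iff (hn : 0 < n) (hD : D ⊆ staircase n) :
    IsReduced n D ↔ IsAscending D (staircaseTiles 0 (n - 1)) := by
  have hD' : ∀ t ∈ D, t.1 + t.2 + 1 < n := fun t ht => (Finset.mem_filter.1 (hD ht)).2
  have h := (runTiles_staircaseTiles hD' (j := 0) (k := n - 1) (by omega)).2
  rw [columnState_zero] at h
  rw [← nodup_crossings_iff, h,
    List.nodup_map_iff_inj_on ((nodup_staircaseTiles 0 (n - 1)).filter _)]
  have hm : ∀ c, c ∈ (staircaseTiles 0 (n - 1)).filter (· ∈ D) ↔ c ∈ D := by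
    intro c
    rw [List.mem_filter, ← List.mem_toFinset, toFinset_staircaseTiles, decide_eq_true_iff]
    exact and_iff_right_of_imp fun h => hD h
  simp only [hm, IsReduced]

theorem runTiles_eq_topLabel (hD : D ⊆ staircase n) {p : ℕ} (hp : p < n) :
    runTiles D id (staircaseTiles 0 (n - 1)) p = topLabel n D 0 p := by
  have hD' : ∀ t ∈ D, t.1 + t.2 + 1 < n := fun t ht => (Finset.mem_filter.1 (hD ht)).2
  have h := (runTiles_staircaseTiles hD' (j := 0) (k := n - 1) (by omega)).1
  rw [columnState_zero] at h
  rw [h, columnState]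
  split_ifs with h1
  · rfl
  · rw [topLabel_eq_sideLabel hD' (by omega)]
    congr 1 <;> omega

end Labels

/-- A permutation of `Fin n`, extended to `ℕ` by fixed points. -/
def extend {n : ℕ} (w : Equiv.Perm (Fin n)) (i : ℕ) : ℕ := if h : i < n then w ⟨i, h⟩ else i

/-- The principal specialization of the Schubert polynomial, as a number of pipe dreams, is the
value at `1` of the Schubert polynomial of the inverse permutation. -/
theorem upsilon_eq_schubertValue {R : Type*} [CommRing R] {n : ℕ} (hn : 0 < n)
    (w : Equiv.Perm (Fin n)) :
    (Upsilon w : R) = schubertValue n (fun _ => (1 : R)) (extend w⁻¹) := by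
  classical
  rw [schubertValue, ← prod_staircaseTiles, ← card_isAscending (nodup_staircaseTiles _ _), Upsilon,
    reducedPipeDreams, toFinset_staircaseTiles]
  congr 2
  refine Finset.filter_congr fun D hD => ?_
  rw [Finset.mem_powerset] at hD
  rw [isReduced_iff hn hD]
  refine and_congr_right fun _ => ?_
  constructor
  · intro h
    funext p
    by_cases hp : p < n
    · rw [runTiles_eq_topLabel hD hp, extend, dif_pos hp, ← h (w⁻¹ ⟨p, hp⟩)]
      simp
    · rw [extend, dif_neg hp, runTiles_of_le D _ (show n ≤ p by omega)]
      intro t ht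
      rw [mem_staircaseTiles] at ht
      omega
  · intro h i
    rw [← runTiles_eq_topLabel hD (w i).2, h, extend, dif_pos (w i).2]
    simp

end PipeDreams

/-! ### Evaluation of Schubert polynomials by Monk's rule -/

/-- Among the entries `l` at the positions `k, k + 1, …`, the positions of those which are above
`c`, and below `bound` and all preceding entries above `c`. -/
def coversAbove (c : ℕ) : ℕ → ℕ → List ℕ → List ℕ
  | _, _, [] => []
  | k, bound, x :: l =>
    bif Nat.blt c x && Nat.blt x bound then k :: coversAbove c (k + 1) x l
    else coversAbove c (k + 1) bound l

/-- Among the entries `l` at the positions `k - 1, …, 0`, the positions of those which are below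
`c`, not below `bound`, and above all preceding entries below `c`. -/
def coversBelow (c : ℕ) : ℕ → ℕ → List ℕ → List ℕ
  | k + 1, bound, x :: l =>
    bif Nat.blt x c && Nat.ble bound x then k :: coversBelow c k (x + 1) l
    else coversBelow c k bound l
  | _, _, _ => []

open Classical in
theorem sum_coversAbove {R : Type*} [AddCommMonoid R] {v : ℕ → ℕ} (hv : Function.Injective v)
    (f : ℕ → R) (r : ℕ) {k m bound : ℕ} (hk : r < k)
    (h1 : ∀ j, r < j → j < k → ¬ (v r < v j ∧ v j < bound))
    (h2 : ∀ j, k ≤ j → j < k + m → bound ≤ v j → ∃ i, r < i ∧ i < k ∧ v r < v i ∧ v i < v j) :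
    ((coversAbove (v r) k bound ((List.range' k m).map v)).map f).sum =
      ∑ j ∈ Finset.Ico k (k + m), if IsCover v r j then f j else 0 := by
  induction m generalizing k bound with
  | zero => simp [coversAbove]
  | succ m ih =>
    rw [List.range'_succ, List.map_cons, coversAbove, Finset.sum_eq_sum_Ico_succ_bot (by omega),
      show k + (m + 1) = k + 1 + m by omega]
    have hb : (Nat.blt (v r) (v k) && Nat.blt (v k) bound) = true ↔
        v r < v k ∧ v k < bound := by
      simp [Nat.blt_eq]
    by_cases hc : v r < v k ∧ v k < bound
    · have hcov : IsCover v r k := ⟨hc.1, fun j hj hjk h => h1 j hj hjk ⟨h.1, by omega⟩⟩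
      rw [hb.2 hc, cond_true, List.map_cons, List.sum_cons, if_pos hcov]
      congr 1
      refine ih (by omega) (fun j hj hjk h => ?_) (fun j hj hjm h => ?_)
      · rcases (show j < k ∨ j = k by omega) with hjk' | rfl
        · exact h1 j hj hjk' ⟨h.1, by omega⟩
        · omega
      · refine ⟨k, hk, by omega, hc.1, lt_of_le_of_ne h fun e => ?_⟩
        have := hv e
        omega
    · rw [Bool.eq_false_iff.2 fun h => hc (hb.1 h), cond_false]
      have hcov : ¬ IsCover v r k := fun h => by
        obtain ⟨i, hi, hik, h3, h4⟩ := h2 k le_rfl (by omega) (not_lt.1 fun h' => hc ⟨h.1, h'⟩)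
        exact h.2 i hi hik ⟨h3, h4⟩
      rw [if_neg hcov, zero_add]
      refine ih (by omega) (fun j hj hjk h => ?_) (fun j hj hjm h => ?_)
      · rcases (show j < k ∨ j = k by omega) with hjk' | rfl
        · exact h1 j hj hjk' h
        · exact hc h
      · obtain ⟨i, hi, hik, h3⟩ := h2 j (by omega) (by omega) h
        exact ⟨i, hi, by omega, h3⟩

open Classical in
theorem sum_coversBelow {R : Type*} [AddCommMonoid R] {v : ℕ → ℕ} (hv : Function.Injective v)
    (f : ℕ → R) (r : ℕ) {k bound : ℕ} (hk : k ≤ r)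
    (h1 : ∀ j, k ≤ j → j < r → ¬ (bound ≤ v j ∧ v j < v r))
    (h2 : ∀ j, j < k → v j < bound → ∃ i, k ≤ i ∧ i < r ∧ v j < v i ∧ v i < v r) :
    ((coversBelow (v r) k bound ((List.range k).map v).reverse).map f).sum =
      ∑ j ∈ Finset.range k, if IsCover v j r then f j else 0 := by
  induction k generalizing bound with
  | zero => simp [coversBelow]
  | succ k ih =>
    rw [List.range_succ, List.map_append, List.reverse_append, Finset.sum_range_succ]
    simp only [List.map_cons, List.map_nil, List.reverse_cons, List.reverse_nil, List.nil_append,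
      List.singleton_append, coversBelow]
    have hb : (Nat.blt (v k) (v r) && Nat.ble bound (v k)) = true ↔
        v k < v r ∧ bound ≤ v k := by
      simp [Nat.blt_eq]
    by_cases hc : v k < v r ∧ bound ≤ v k
    · have hcov : IsCover v k r := ⟨hc.1, fun j hj hjr h => h1 j (by omega) hjr ⟨by omega, h.2⟩⟩
      rw [hb.2 hc, cond_true, List.map_cons, List.sum_cons, if_pos hcov, add_comm]
      congr 1
      refine ih (by omega) (fun j hj hjr h => ?_) (fun j hj h => ?_)
      · rcases (show j = k ∨ k + 1 ≤ j by omega) with rfl | hjk'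
        · omega
        · exact h1 j hjk' hjr ⟨by omega, h.2⟩
      · refine ⟨k, le_rfl, by omega, lt_of_le_of_ne (by omega) fun e => ?_, hc.1⟩
        have := hv e
        omega
    · rw [Bool.eq_false_iff.2 fun h => hc (hb.1 h), cond_false]
      have hcov : ¬ IsCover v k r := fun h => by
        obtain ⟨i, hi, hir, h3, h4⟩ := h2 k (by omega) (not_le.1 fun h' => hc ⟨h.1, h'⟩)
        exact h.2 i (by omega) hir ⟨h3, h4⟩
      rw [if_neg hcov, add_zero]
      refine ih (by omega) (fun j hj hjr h => ?_) (fun j hj h => ?_)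
      · rcases (show j = k ∨ k + 1 ≤ j by omega) with rfl | hjk'
        · exact hc ⟨h.2, h.1⟩
        · exact h1 j hjk' hjr h
      · obtain ⟨i, hi, h3⟩ := h2 j (by omega) h
        exact ⟨i, by omega, h3⟩

/-- Exchange the entries at the positions `a` and `b`. -/
def swapEntries (a b : ℕ) (l : List ℕ) : List ℕ := (l.set a (l.getD b b)).set b (l.getD a a)

theorem length_swapEntries (a b : ℕ) (l : List ℕ) : (swapEntries a b l).length = l.length := by
  simp [swapEntries]

theorem ofList_swapEntries {a b : ℕ} {l : List ℕ} (ha : a < l.length) (hb : b < l.length) :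
    ofList (swapEntries a b l) = ofList l ∘ Equiv.swap a b := by
  funext i
  simp only [ofList, swapEntries, Function.comp, List.getD_eq_getElem?_getD, List.getElem?_set,
    Equiv.swap_apply_def, List.length_set]
  by_cases h1 : i = b
  · subst h1
    by_cases h2 : i = a
    · subst h2; simp [ha]
    · simp [h2, hb, ha]
  · by_cases h2 : i = a
    · subst h2; simp [ha, hb, Ne.symm h1]
    · simp [h1, h2, Ne.symm h1, Ne.symm h2]

/-- The positions `k > r` such that exchanging the entries at `r` and `k` adds one inversion. -/
def upperCovers (l : List ℕ) (r : ℕ) : List ℕ :=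
  coversAbove (l.getD r r) (r + 1) l.length (l.drop (r + 1))

/-- The positions `k < r` such that exchanging the entries at `k` and `r` adds one inversion. -/
def lowerCovers (l : List ℕ) (r : ℕ) : List ℕ :=
  coversBelow (l.getD r r) r 0 (l.take r).reverse

theorem lt_of_mem_coversAbove {c k bound j : ℕ} {l : List ℕ} (h : j ∈ coversAbove c k bound l) :
    k ≤ j ∧ j < k + l.length := by
  induction l generalizing k bound with
  | nil => simp [coversAbove] at h
  | cons x l ih =>
    rw [coversAbove] at h
    rw [List.length_cons]
    cases hb : (Nat.blt c x && Nat.blt x bound) <;> simp only [hb, cond_true, cond_false] at h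
    · have := ih h; omega
    · rcases List.mem_cons.1 h with rfl | h
      · omega
      · have := ih h; omega

theorem lt_of_mem_coversBelow {c k bound j : ℕ} {l : List ℕ} (h : j ∈ coversBelow c k bound l) :
    j < k := by
  induction l generalizing k bound with
  | nil => cases k <;> simp [coversBelow] at h
  | cons x l ih =>
    cases k with
    | zero => simp [coversBelow] at h
    | succ k =>
      rw [coversBelow] at h
      cases hb : (Nat.blt x c && Nat.ble bound x) <;> simp only [hb, cond_true, cond_false] at h
      · have := ih h; omega
      · rcases List.mem_cons.1 h with rfl | h
        · omega
        · have := ih h; omega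

/-- Injectivity forces the entries of a one-line notation to be small. -/
theorem ofList_lt {l : List ℕ} (hl : Function.Injective (ofList l)) {i : ℕ} (hi : i < l.length) :
    ofList l i < l.length := by
  by_contra h
  have h1 : ofList l (ofList l i) = ofList l i := by
    conv_lhs => rw [ofList]
    rw [List.getD_eq_default _ _ (by omega)]
  have := hl h1
  omega

theorem map_ofList_range' {l : List ℕ} {k : ℕ} :
    l.drop k = (List.range' k (l.length - k)).map (ofList l) := by
  refine List.ext_getElem (by simp) fun i h1 h2 => ?_
  have : k + i < l.length := by simp at h1; omega
  simp [ofList, this]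

theorem map_ofList_range {l : List ℕ} {k : ℕ} (hk : k ≤ l.length) :
    l.take k = (List.range k).map (ofList l) := by
  refine List.ext_getElem (by simp [hk]) fun i h1 h2 => ?_
  have : i < l.length := by simp at h1; omega
  simp [ofList, this]

/-- Monk's rule at `x = 1`, in one-line notation. -/
theorem schubertValue_eq_sum_covers {l : List ℕ} (hl : Function.Injective (ofList l)) {r : ℕ}
    (hr : r + 1 < l.length) (hlast : ofList l (l.length - 1) = l.length - 1) :
    schubertValue l.length (fun _ => (1 : ℚ)) (ofList l) =
      ((upperCovers l r).map fun k =>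
        schubertValue l.length (fun _ => (1 : ℚ)) (ofList (swapEntries r k l))).sum -
      ((lowerCovers l r).map fun k =>
        schubertValue l.length (fun _ => (1 : ℚ)) (ofList (swapEntries k r l))).sum := by
  classical
  have hn : ∀ i, l.length ≤ i + 1 → ofList l i = i := by
    intro i hi
    by_cases h : i = l.length - 1
    · rw [h, hlast]
    · rw [ofList, List.getD_eq_default _ _ (by omega)]
  have h := mul_schubertValue (fun _ => (1 : ℚ)) hl hn hr
  rw [one_mul] at h
  have e1 : ((upperCovers l r).map fun k =>
      schubertValue l.length (fun _ => (1 : ℚ)) (ofList (swapEntries r k l))).sum =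
      ∑ k ∈ Finset.range l.length, if r < k ∧ IsCover (ofList l) r k then
        schubertValue l.length (fun _ => (1 : ℚ)) (ofList l ∘ Equiv.swap r k) else 0 := by
    have e := sum_coversAbove hl (fun k =>
      schubertValue l.length (fun _ => (1 : ℚ)) (ofList l ∘ Equiv.swap r k)) r (k := r + 1)
      (m := l.length - (r + 1)) (bound := l.length) (by omega) (fun j h1 h2 => by omega)
      (fun j h1 h2 h3 => by
        have := ofList_lt hl (i := j) (by omega)
        omega)
    rw [← map_ofList_range', show r + 1 + (l.length - (r + 1)) = l.length by omega] at e
    have e' : (upperCovers l r).map (fun k =>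
        schubertValue l.length (fun _ => (1 : ℚ)) (ofList (swapEntries r k l))) =
        (upperCovers l r).map fun k =>
          schubertValue l.length (fun _ => (1 : ℚ)) (ofList l ∘ Equiv.swap r k) := by
      refine List.map_congr_left fun k hk => ?_
      have := lt_of_mem_coversAbove hk
      rw [List.length_drop] at this
      rw [ofList_swapEntries (by omega) (by omega)]
    rw [e']
    refine e.trans ?_
    rw [Finset.range_eq_Ico, ← Finset.sum_Ico_consecutive _ (Nat.zero_le (r + 1)) hr.le,
      Finset.sum_eq_zero (s := Finset.Ico 0 (r + 1)), zero_add]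
    · refine Finset.sum_congr rfl fun k hk => ?_
      have : r < k := by have := (Finset.mem_Ico.1 hk).1; omega
      simp [this]
    · intro k hk
      have : ¬ r < k := by have := (Finset.mem_Ico.1 hk).2; omega
      simp [this]
  have e2 : ((lowerCovers l r).map fun k =>
      schubertValue l.length (fun _ => (1 : ℚ)) (ofList (swapEntries k r l))).sum =
      ∑ k ∈ Finset.range l.length, if k < r ∧ IsCover (ofList l) k r then
        schubertValue l.length (fun _ => (1 : ℚ)) (ofList l ∘ Equiv.swap k r) else 0 := by
    have e := sum_coversBelow hl (fun k =>
      schubertValue l.length (fun _ => (1 : ℚ)) (ofList l ∘ Equiv.swap k r)) r (k := r)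
      (bound := 0) le_rfl (fun j h1 h2 => by omega) (fun j h1 h2 => by omega)
    rw [← map_ofList_range (by omega)] at e
    have e' : (lowerCovers l r).map (fun k =>
        schubertValue l.length (fun _ => (1 : ℚ)) (ofList (swapEntries k r l))) =
        (lowerCovers l r).map fun k =>
          schubertValue l.length (fun _ => (1 : ℚ)) (ofList l ∘ Equiv.swap k r) := by
      refine List.map_congr_left fun k hk => ?_
      have := lt_of_mem_coversBelow hk
      rw [ofList_swapEntries (by omega) (by omega)]
    rw [e']
    refine e.trans ?_
    rw [Finset.range_eq_Ico (l.length), ← Finset.sum_Ico_consecutive _ (Nat.zero_le r) (by omega),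
      Finset.sum_eq_zero (s := Finset.Ico r l.length), add_zero, Finset.range_eq_Ico]
    · refine Finset.sum_congr rfl fun k hk => ?_
      have : k < r := (Finset.mem_Ico.1 hk).2
      simp [this]
    · intro k hk
      have : ¬ k < r := by have := (Finset.mem_Ico.1 hk).1; omega
      simp [this]
  rw [h, e1, e2, ← Finset.sum_sub_distrib]
  rfl

/-- The sum of the values of `f` on a list, if all of them are defined. -/
def sumDefined (f : ℕ → Option ℤ) : List ℕ → Option ℤ
  | [] => some 0
  | k :: ks =>
    match f k with
    | none => none
    | some a => (sumDefined f ks).map (a + ·)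

theorem sum_eq_of_sumDefined {f : ℕ → Option ℤ} {g : ℕ → ℚ} {ks : List ℕ} {z : ℤ}
    (h : sumDefined f ks = some z) (hf : ∀ k ∈ ks, ∀ a, f k = some a → g k = a) :
    (ks.map g).sum = z := by
  induction ks generalizing z with
  | nil => simp [sumDefined] at h; simp [← h]
  | cons k ks ih =>
    cases hk : f k with
    | none => simp [sumDefined, hk] at h
    | some a =>
      simp only [sumDefined, hk, Option.map_eq_some_iff] at h
      obtain ⟨b, hb, rfl⟩ := h
      rw [List.map_cons, List.sum_cons, hf k List.mem_cons_self a hk,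
        ih hb fun k hk => hf k (List.mem_cons_of_mem _ hk)]
      push_cast
      rfl

/-- Compute a principal specialization by Monk's rule, applied to `v = w (r s)` where `(r, s)` is
the inversion of `w` given by `inv`; the permutations without such an inversion are left to
`leaf`. -/
def monkEval (inv : List ℕ → Option (ℕ × ℕ)) (leaf : List ℕ → Option ℤ) :
    ℕ → List ℕ → Option ℤ
  | 0, _ => none
  | fuel + 1, w =>
    match inv w with
    | none => leaf w
    | some (r, s) =>
      let v := swapEntries r s w
      let ks := upperCovers v r
      bif ks.contains s && Nat.beq (v.getD (v.length - 1) 0) (v.length - 1) then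
        match monkEval inv leaf fuel v,
          sumDefined (fun k => monkEval inv leaf fuel (swapEntries r k v)) (ks.erase s),
          sumDefined (fun k => monkEval inv leaf fuel (swapEntries k r v)) (lowerCovers v r) with
        | some a, some b, some c => some (a - b + c)
        | _, _, _ => none
      else none

theorem schubertValue_eq_of_monkEval {n : ℕ} {inv : List ℕ → Option (ℕ × ℕ)}
    {leaf : List ℕ → Option ℤ}
    (hleaf : ∀ w z, leaf w = some z → schubertValue n (fun _ => (1 : ℚ)) (ofList w) = z)
    {fuel : ℕ} {w : List ℕ} (hn : w.length = n) (hw : Function.Injective (ofList w)) {z : ℤ}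
    (h : monkEval inv leaf fuel w = some z) :
    schubertValue n (fun _ => (1 : ℚ)) (ofList w) = z := by
  induction fuel generalizing w z with
  | zero => simp [monkEval] at h
  | succ fuel ih =>
    rw [monkEval] at h
    cases hi : inv w with
    | none => rw [hi] at h; exact hleaf w z h
    | some rs =>
      obtain ⟨r, s⟩ := rs
      simp only [hi] at h
      set v := swapEntries r s w with hv
      cases hb : ((upperCovers v r).contains s &&
        Nat.beq (v.getD (v.length - 1) 0) (v.length - 1)) with
      | false => rw [hb] at h; simp at h
      | true =>
        rw [hb, cond_true] at h
        rw [Bool.and_eq_true, List.contains_iff_mem] at hb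
        obtain ⟨hs, hb⟩ := hb
        have hlast := Nat.eq_of_beq_eq_true hb
        have hvn : v.length = n := by rw [hv, length_swapEntries, hn]
        have hrs : r < s ∧ s < n := by
          have := lt_of_mem_coversAbove hs
          rw [List.length_drop] at this
          omega
        have hvw : ofList v = ofList w ∘ Equiv.swap r s :=
          ofList_swapEntries (by omega) (by omega)
        have hinj : Function.Injective (ofList v) := by
          rw [hvw]; exact hw.comp (Equiv.injective _)
        have hinj' : ∀ a b, a < n → b < n →
            Function.Injective (ofList (swapEntries a b v)) := fun a b ha hb => by
          rw [ofList_swapEntries (by omega) (by omega)]; exact hinj.comp (Equiv.injective _)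
        have hlast' : ofList v (v.length - 1) = v.length - 1 := by
          rw [ofList, List.getD_eq_getElem _ _ (by omega)]
          rwa [List.getD_eq_getElem _ _ (by omega)] at hlast
        have hback : ofList (swapEntries r s v) = ofList w := by
          rw [ofList_swapEntries (by omega) (by omega), hvw]
          funext i
          simp
        have key := schubertValue_eq_sum_covers hinj (r := r) (by omega) hlast'
        rw [← List.sum_map_erase _ hs, hback, hvn] at key
        cases ha : monkEval inv leaf fuel v with
        | none => simp [ha] at h
        | some a =>
        cases hb : sumDefined (fun k => monkEval inv leaf fuel (swapEntries r k v))
          ((upperCovers v r).erase s) with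
        | none => simp [ha, hb] at h
        | some b =>
        cases hc : sumDefined (fun k => monkEval inv leaf fuel (swapEntries k r v))
          (lowerCovers v r) with
        | none => simp [ha, hb, hc] at h
        | some c =>
        simp only [ha, hb, hc, Option.some.injEq] at h
        have h1 := ih hvn hinj ha
        have h2 := sum_eq_of_sumDefined hb (g := fun k =>
          schubertValue n (fun _ => (1 : ℚ)) (ofList (swapEntries r k v))) fun k hk a h' => by
            have := lt_of_mem_coversAbove (List.mem_of_mem_erase hk)
            rw [List.length_drop] at this
            exact ih (by rw [length_swapEntries, hvn]) (hinj' _ _ (by omega) (by omega)) h'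
        have h3 := sum_eq_of_sumDefined hc (g := fun k =>
          schubertValue n (fun _ => (1 : ℚ)) (ofList (swapEntries k r v))) fun k hk a h' => by
            have := lt_of_mem_coversBelow hk
            exact ih (by rw [length_swapEntries, hvn]) (hinj' _ _ (by omega) (by omega)) h'
        rw [h1, h2, h3] at key
        rw [← h]
        push_cast
        linarith

/-! ### Direct sums in one-line notation -/

section Append

variable {R : Type*} [CommRing R]

theorem ofList_append (u v : List ℕ) (i : ℕ) :
    ofList (u ++ v) i = if i < u.length then ofList u i else v.getD (i - u.length) i := by
  split_ifs with h
  · exact List.getD_append _ _ _ _ h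
  · exact List.getD_append_right _ _ _ _ (by omega)

theorem ofList_of_le {l : List ℕ} {i : ℕ} (h : l.length ≤ i) : ofList l i = i :=
  List.getD_eq_default _ _ h

theorem ofList_range (n : ℕ) : ofList (List.range n) = id := by
  funext i
  by_cases h : i < n <;> simp [ofList, h]

/-- The Schubert polynomial of a direct sum, in one-line notation. -/
theorem schubertValue_append {n : ℕ} (x : ℕ → R) {u v : List ℕ} (hn : u.length ≤ n)
    (hu : ∀ a ∈ u, a < u.length) (hv : ∀ a ∈ v, u.length ≤ a) :
    schubertValue n x (ofList (u ++ v)) = schubertValue u.length x (ofList u) *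
      schubertValue n x (ofList (List.range u.length ++ v)) := by
  have hu' : ∀ i, i < u.length → ofList u i < u.length := fun i hi => by
    rw [ofList, List.getD_eq_getElem _ _ hi]
    exact hu _ (List.getElem_mem hi)
  have hv' : ∀ i, u.length ≤ i → u.length ≤ ofList (List.range u.length ++ v) i := fun i hi => by
    rw [ofList_append, List.length_range, if_neg (by omega)]
    by_cases h : i - u.length < v.length
    · rw [List.getD_eq_getElem _ _ h]
      exact hv _ (List.getElem_mem h)
    · rw [List.getD_eq_default _ _ (by omega)]
      exact hi
  have h := schubertValue_glue hn x hu' hv'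
  have e1 : glue u.length (ofList u) (ofList (List.range u.length ++ v)) = ofList (u ++ v) := by
    funext i
    simp only [glue, ofList_append, List.length_range]
    split_ifs <;> rfl
  have e2 : glue u.length (ofList u) id = ofList u := by
    funext i
    simp only [glue]
    split_ifs with hi
    · rfl
    · exact (ofList_of_le (not_lt.1 hi)).symm
  have e3 : glue u.length id (ofList (List.range u.length ++ v)) =
      ofList (List.range u.length ++ v) := by
    funext i
    simp only [glue, ofList_append, List.length_range, ofList_range]
    split_ifs <;> rfl
  rwa [e1, e2, e3] at h

end Append

/-! ### Layered permutations -/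

/-- The one-line notation of `m` fixed points followed by a reversed block of size `b`. -/
def blockList (m b : ℕ) : List ℕ := List.range m ++ (List.range' m b).reverse

/-- The one-line notation, after `m` entries, of reversed blocks of given sizes. -/
def layeredList : ℕ → List ℕ → List ℕ
  | _, [] => []
  | m, b :: bs => (List.range' m b).reverse ++ layeredList (m + b) bs

theorem le_of_mem_layeredList {m a : ℕ} {bs : List ℕ} (h : a ∈ layeredList m bs) : m ≤ a := by
  induction bs generalizing m with
  | nil => simp [layeredList] at h
  | cons b bs ih =>
    rw [layeredList, List.mem_append, List.mem_reverse, List.mem_range'_1] at h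
    rcases h with h | h
    · exact h.1
    · have := ih h; omega

/-- The Schubert polynomial of a layered permutation is a product over its blocks. -/
theorem schubertValue_layeredList {R : Type*} [CommRing R] {n m b : ℕ} (x : ℕ → R) (bs : List ℕ)
    (hn : m + b ≤ n) :
    schubertValue n x (ofList (List.range m ++ layeredList m (b :: bs))) =
      schubertValue (m + b) x (ofList (blockList m b)) *
        schubertValue n x (ofList (List.range (m + b) ++ layeredList (m + b) bs)) := by
  have hl : (blockList m b).length = m + b := by simp [blockList]
  have h := schubertValue_append (n := n) x (u := blockList m b) (v := layeredList (m + b) bs)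
    (by omega) (fun a ha => by
      simp only [blockList, List.mem_append, List.mem_reverse, List.mem_range'_1,
        List.mem_range] at ha
      omega) fun a ha => by
      have := le_of_mem_layeredList ha
      omega
  rw [hl] at h
  rw [← h, layeredList, blockList, List.append_assoc]

theorem layeredList_getD {m k y d : ℕ} {bs : List ℕ} (hk : k < bs.length) (hy : y < bs[k]) :
    (layeredList m bs).getD ((bs.take k).sum + y) d = m + (bs.take k).sum + (bs[k] - 1 - y) := by
  induction bs generalizing m k with
  | nil => simp at hk
  | cons b bs ih =>
    rcases k with _ | k
    · simp only [List.getElem_cons_zero] at hy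
      rw [layeredList, List.getD_append _ _ _ _ (by simpa using hy),
        List.getD_eq_getElem _ _ (by simpa using hy)]
      simp
    · simp only [List.getElem_cons_succ] at hy
      rw [layeredList, List.getD_append_right _ _ _ _ (by simp; omega)]
      have := ih (m := m + b) (k := k) (by simpa using hk) hy
      simp only [List.take_succ_cons, List.sum_cons, List.length_reverse, List.length_range',
        List.getElem_cons_succ]
      rw [show b + (List.take k bs).sum + y - b = (List.take k bs).sum + y by omega, this]
      omega

theorem layered_embedding {n : ℕ} (c : Composition n) (i : Fin c.length)
    (y : Fin (c.blocksFun i)) : layered c (c.embedding i y) = c.embedding i y.rev := by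
  have h : c.embedding i y = c.blocksFinEquiv ⟨i, y⟩ := rfl
  rw [h, layered, Equiv.permCongr_apply, Equiv.symm_apply_apply]
  rfl

theorem layered_inv {n : ℕ} (c : Composition n) : (layered c)⁻¹ = layered c := by
  refine inv_eq_of_mul_eq_one_left (Equiv.ext fun p => ?_)
  obtain ⟨⟨i, y⟩, rfl⟩ := c.blocksFinEquiv.surjective p
  have h : c.blocksFinEquiv ⟨i, y⟩ = c.embedding i y := rfl
  rw [h, Equiv.Perm.mul_apply, layered_embedding, layered_embedding, Fin.rev_rev]
  rfl

theorem extend_layered_inv {n : ℕ} (c : Composition n) :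
    extend (layered c)⁻¹ = ofList (layeredList 0 c.blocks) := by
  have hlen : ∀ (bs : List ℕ) (m : ℕ), (layeredList m bs).length = bs.sum := by
    intro bs
    induction bs with
    | nil => intro m; rfl
    | cons b bs ih => intro m; simp [layeredList, ih]
  rw [layered_inv]
  funext p
  by_cases hp : p < n
  · rw [extend, dif_pos hp]
    obtain ⟨⟨i, y⟩, hi⟩ := c.blocksFinEquiv.surjective ⟨p, hp⟩
    have h : c.blocksFinEquiv ⟨i, y⟩ = c.embedding i y := rfl
    have hp' : p = c.sizeUpTo i + y := by
      have := congrArg Fin.val hi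
      rw [h] at this
      simpa using this.symm
    rw [← hi, h, layered_embedding, hp']
    have := layeredList_getD (m := 0) (d := c.sizeUpTo i + y) (bs := c.blocks) (k := i) i.2 y.2
    rw [ofList]
    refine Eq.trans ?_ this.symm
    simp only [Composition.coe_embedding, Fin.val_rev, zero_add]
    have hy := y.2
    have hb : c.blocksFun i = c.blocks[(i : ℕ)]'i.2 := rfl
    rw [Composition.sizeUpTo]
    omega
  · rw [extend, dif_neg hp, ofList_of_le]
    rw [hlen, c.blocks_sum]
    omega

/-! ### Numerical values -/

/-- A word leading from the longest permutation of `0, …, n - 1` to `blockList m (n - m)`. -/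
def blockWord (n m : ℕ) : List ℕ :=
  (List.range (n - 1)).reverse.flatMap fun p => List.range' p (min (n - 1 - p) m)

/-- For each `m`, the maximum of the principal specialization over the layered permutations of
`0, …, 16` fixing `0, …, m - 1`. -/
def layeredMax : List ℚ :=
  [3050684475186219300000, 3050684475186219300000, 2745616027667597370000, 1525342237593109650000,
    254223706265518275000, 28622389306817092500, 28622389306817092500, 4622249204827605000,
    171879976152056250, 2045253720802500, 10670888978100, 33309352440, 85408596, 251720, 1240, 16,
    1, 1]

/-- Check the recursive inequality for `layeredMax`, for a first block of size `b` after `m` fixed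
points. -/
def checkBlock (m b : ℕ) : Bool :=
  match wordValue (m + b) (blockWord (m + b) m) with
  | some (w, q) => decide (w = blockList m b) && decide (0 ≤ q) &&
      decide (q * layeredMax.getD (m + b) 0 ≤ layeredMax.getD m 0)
  | none => false

/-- The permutation with `16` at position `i` and `j` at position `16`, in which the entries up to
`7` other than `j` come first in increasing order, and then the other ones in decreasing order. -/
def leafList (i j : ℕ) : List ℕ :=
  let l := (List.range 8).erase j
  l.take i ++ 16 :: l.drop i ++ (List.range' 8 8).reverse ++ [j]

/-- A word leading from the longest permutation to `leafList i j`: the entries `j + 1, …, 7` are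
sorted, then the entries below `j`, these are moved before `j, …, 7`, then the entries
`8, …, 15` are moved back, and finally `16` is moved to its place. -/
def leafWord (i j : ℕ) : List ℕ :=
  ((List.range (6 - j)).flatMap fun t => (List.range' 9 (t + 1)).reverse) ++
    (blockWord j j).map (17 - j + ·) ++ List.range' (16 - j) j ++
    ((List.range (7 - j)).reverse.flatMap fun t => List.range' (9 + t) j) ++
    ((List.range 8).reverse.flatMap fun p => List.range' (p + 1) 7) ++ List.range' 0 i

/-- Triples `(i, j, z)` with `z` the principal specialization for `leafList i j`. -/
def leafTable : List (ℕ × ℕ × ℤ) :=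
  [(0, 6, 13105071207335250), (1, 5, 169556028696697500), (1, 6, 167962201373698875),
    (2, 4, 656467212111252750), (2, 5, 977868922341621375), (2, 6, 973185440170554000),
    (3, 4, 2236157737829851875), (3, 5, 3347490383716869000), (3, 6, 3347658492315403500),
    (4, 2, 656467212111252750), (4, 3, 2236157737829851875), (4, 4, 4979473131017521500),
    (4, 5, 7492197892509252000), (4, 6, 7530465970138000500), (5, 1, 169556028696697500),
    (5, 2, 977868922341621375), (5, 3, 3347490383716869000), (5, 4, 7492197892509252000),
    (5, 5, 11331471949100082000), (5, 6, 11448765037367511750), (6, 0, 13105071207335250),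
    (6, 1, 167962201373698875), (6, 2, 973185440170554000), (6, 3, 3347658492315403500),
    (6, 4, 7530465970138000500), (6, 5, 11448765037367511750), (6, 6, 11628575613533502000),
    (7, 0, 8012241391386375), (7, 1, 103114063123929000), (7, 2, 600063043019719500),
    (7, 3, 2073682080268695000), (7, 4, 4687319558652558750), (7, 5, 7162313758705755000),
    (7, 6, 7312624540622797500)]

/-- Look up a principal specialization in `leafTable`, in the symmetric group of `0, …, 17`. -/
def leafValue (w : List ℕ) : Option ℤ :=
  let i := w.idxOf 16
  let j := w.getD 16 0
  match leafTable.find? fun e => Nat.beq e.1 i && Nat.beq e.2.1 j with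
  | some e => if w = leafList i j ++ [17] then some e.2.2 else none
  | none => none

/-- The positions and values of the entries up to `7`, among those at positions `k, k + 1, …`. -/
def smallEntries : ℕ → List ℕ → List (ℕ × ℕ)
  | _, [] => []
  | k, x :: l => bif Nat.ble x 7 then (k, x) :: smallEntries (k + 1) l else smallEntries (k + 1) l

/-- The last entry followed by a smaller one, and the entries after it. -/
def lastDescent : List (ℕ × ℕ) → Option ((ℕ × ℕ) × List (ℕ × ℕ))
  | [] => none
  | p :: l =>
    match lastDescent l with
    | some t => some t
    | none =>
      match l with
      | [] => none
      | q :: _ => bif Nat.blt q.2 p.2 then some (p, l) else none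

/-- The inversion to which Monk's rule is applied: its first position is that of the last descent
among the entries up to `7` at the positions before `16`, and its second position is as large as
possible. -/
def monkInversion (w : List ℕ) : Option (ℕ × ℕ) :=
  (lastDescent (smallEntries 0 (w.take 16))).map fun t =>
    (t.1.1, t.2.foldl (fun s q => bif Nat.blt q.2 t.1.2 then q.1 else s) 0)

theorem checkBlock_eq_true : ∀ m < 17, ∀ b < 17 - m, checkBlock m (b + 1) = true := by
  decide +kernel

/-- The values in `leafTable` are those of the flagged determinants. -/
theorem wordValue_leafWord : ∀ e ∈ leafTable,
    wordValue 17 (leafWord e.1 e.2.1) = some (leafList e.1 e.2.1, (e.2.2 : ℚ)) := by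
  decide +kernel

theorem monkEval_uStar : monkEval monkInversion leafValue 100
    [0, 1, 2, 7, 5, 4, 16, 3, 15, 14, 13, 12, 11, 10, 9, 8, 6, 17] =
      some 1764222757921488744750 := by
  decide +kernel

theorem monkEval_wStar_inv : monkEval monkInversion leafValue 100
    [0, 1, 2, 7, 5, 4, 3, 16, 15, 14, 13, 12, 11, 10, 9, 8, 6, 17] =
      some 1636212300198568560000 := by
  decide +kernel

/-! ### The layered maximum -/

theorem exists_of_checkBlock {m b : ℕ} (h : checkBlock m b = true) :
    ∃ q : ℚ, schubertValue (m + b) (fun _ => (1 : ℚ)) (ofList (blockList m b)) = q ∧ 0 ≤ q ∧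
      q * layeredMax.getD (m + b) 0 ≤ layeredMax.getD m 0 := by
  rw [checkBlock] at h
  cases hq : wordValue (m + b) (blockWord (m + b) m) with
  | none => rw [hq] at h; simp at h
  | some wq =>
    obtain ⟨w, q⟩ := wq
    rw [hq] at h
    simp only [Bool.and_eq_true, decide_eq_true_eq] at h
    obtain ⟨⟨rfl, h0⟩, h1⟩ := h
    exact ⟨q, schubertValue_eq_of_wordValue hq, h0, h1⟩

theorem schubertValue_layeredList_le {m : ℕ} {bs : List ℕ} (hpos : ∀ b ∈ bs, 0 < b)
    (hsum : m + bs.sum = 17) :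
    schubertValue 17 (fun _ => (1 : ℚ)) (ofList (List.range m ++ layeredList m bs)) ≤
      layeredMax.getD m 0 := by
  induction bs generalizing m with
  | nil =>
    obtain rfl : m = 17 := by simpa using hsum
    rw [layeredList, List.append_nil, ofList_range, schubertValue_id]
    exact le_refl _
  | cons b bs ih =>
    have hb : 0 < b := hpos b (by simp)
    rw [List.sum_cons] at hsum
    obtain ⟨q, h1, h2, h3⟩ := exists_of_checkBlock
      (checkBlock_eq_true m (by omega) (b - 1) (by omega))
    rw [Nat.sub_add_cancel hb] at h1 h3
    rw [schubertValue_layeredList _ bs (by omega), h1]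
    exact (mul_le_mul_of_nonneg_left
      (ih (m := m + b) (fun b' h => hpos b' (by simp [h])) (by omega)) h2).trans h3

theorem upsilon_layered (c : Composition 17) :
    (Upsilon (layered c) : ℚ) =
      schubertValue 17 (fun _ => (1 : ℚ)) (ofList (List.range 0 ++ layeredList 0 c.blocks)) := by
  rw [upsilon_eq_schubertValue (by norm_num), extend_layered_inv]
  rfl

theorem upsilon_layered_le (c : Composition 17) :
    Upsilon (layered c) ≤ 3050684475186219300000 := by
  have h := schubertValue_layeredList_le (m := 0) (bs := c.blocks) (fun b h => c.blocks_pos h)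
    (by rw [zero_add, c.blocks_sum])
  rw [← upsilon_layered] at h
  have e : layeredMax.getD 0 0 = ((3050684475186219300000 : ℕ) : ℚ) := by norm_num [layeredMax]
  rw [e] at h
  exact_mod_cast h

theorem wordValue_blockWord_one : wordValue 1 (blockWord 1 0) = some (blockList 0 1, 1) := by
  decide +kernel

theorem wordValue_blockWord_three : wordValue 3 (blockWord 3 1) = some (blockList 1 2, 2) := by
  decide +kernel

theorem wordValue_blockWord_seven : wordValue 7 (blockWord 7 3) = some (blockList 3 4, 330) := by
  decide +kernel

theorem wordValue_blockWord_seventeen :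
    wordValue 17 (blockWord 17 7) = some (blockList 7 10, 4622249204827605000) := by
  decide +kernel

theorem upsilon_wLayered : Upsilon wLayered = 3050684475186219300000 := by
  have h := upsilon_layered comp17
  have e : comp17.blocks = [1, 2, 4, 10] := rfl
  rw [e, schubertValue_layeredList _ _ (by norm_num), schubertValue_layeredList _ _ (by norm_num),
    schubertValue_layeredList _ _ (by norm_num), schubertValue_layeredList _ _ (by norm_num)] at h
  simp only [Nat.reduceAdd] at h
  rw [schubertValue_eq_of_wordValue wordValue_blockWord_one,
    schubertValue_eq_of_wordValue wordValue_blockWord_three,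
    schubertValue_eq_of_wordValue wordValue_blockWord_seven,
    schubertValue_eq_of_wordValue wordValue_blockWord_seventeen, layeredList, List.append_nil,
    ofList_range, schubertValue_id] at h
  refine Nat.cast_injective (R := ℚ) (h.trans ?_)
  norm_num

/-! ### The two permutations which are not layered -/

theorem schubertValue_of_leafValue {w : List ℕ} {z : ℤ} (h : leafValue w = some z) :
    schubertValue 18 (fun _ => (1 : ℚ)) (ofList w) = z := by
  simp only [leafValue] at h
  cases hf : leafTable.find? fun e => Nat.beq e.1 (w.idxOf 16) && Nat.beq e.2.1 (w.getD 16 0) with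
  | none => rw [hf] at h; simp at h
  | some e =>
    rw [hf] at h
    simp only at h
    have hm := List.mem_of_find?_eq_some hf
    have hp := List.find?_some hf
    simp only [Bool.and_eq_true] at hp
    have h1 := Nat.eq_of_beq_eq_true hp.1
    have h2 := Nat.eq_of_beq_eq_true hp.2
    rw [← h1, ← h2] at h
    split_ifs at h with hw
    rw [Option.some.injEq] at h
    have hperm : ∀ e ∈ leafTable, (leafList e.1 e.2.1).length = 17 ∧
        ∀ a ∈ leafList e.1 e.2.1, a < 17 := by
      decide +kernel
    obtain ⟨hlen, hlt⟩ := hperm e hm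
    have hsame : ofList w = ofList (leafList e.1 e.2.1) := by
      funext i
      rw [hw, ofList_append, hlen]
      split_ifs with hi
      · rfl
      · rw [ofList_of_le (l := leafList e.1 e.2.1) (by omega)]
        rcases (show i = 17 ∨ 18 ≤ i by omega) with rfl | hi'
        · rfl
        · exact List.getD_eq_default _ _ (by simp; omega)
    rw [hsame, schubertValue_stable (show 17 ≤ 18 by norm_num),
      schubertValue_eq_of_wordValue (wordValue_leafWord e hm), ← h]
    · intro i hi
      rw [ofList, List.getD_eq_getElem _ _ (by omega)]
      exact hlt _ (List.getElem_mem _)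
    · intro i hi
      exact ofList_of_le (by omega)

/-- The value obtained from Monk's rule, for a permutation of `0, …, 16` given by its one-line
notation, extended by the fixed point `17`. -/
theorem schubertValue_of_monkEval {l : List ℕ} (hl : l.length = 17)
    (hperm : (l ++ [17]).Perm (List.range 18)) {z : ℤ}
    (h : monkEval monkInversion leafValue 100 (l ++ [17]) = some z) :
    schubertValue 17 (fun _ => (1 : ℚ)) (ofList (l ++ [17])) = z := by
  have hlen : (l ++ [17]).length = 18 := by simp [hl]
  have hnodup : (l ++ [17]).Nodup := hperm.nodup_iff.2 List.nodup_range
  have hmem : ∀ a ∈ l ++ [17], a < 18 := fun a ha => by simpa using hperm.mem_iff.1 ha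
  have hinj : Function.Injective (ofList (l ++ [17])) := by
    have hlt : ∀ i, i < 18 → ofList (l ++ [17]) i < 18 := fun i hi => by
      rw [ofList, List.getD_eq_getElem _ _ (by omega)]
      exact hmem _ (List.getElem_mem _)
    intro i j hij
    by_cases hi : i < 18 <;> by_cases hj : j < 18
    · rw [ofList, ofList, List.getD_eq_getElem _ _ (by omega), List.getD_eq_getElem _ _ (by omega)]
        at hij
      exact (hnodup.getElem_inj_iff).1 hij
    · have := hlt i hi
      rw [hij, ofList_of_le (by omega)] at this
      omega
    · have := hlt j hj
      rw [← hij, ofList_of_le (by omega)] at this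
      omega
    · rwa [ofList_of_le (by omega), ofList_of_le (by omega)] at hij
  have hlast : ∀ i, 17 ≤ i → ofList (l ++ [17]) i = i := by
    intro i hi
    rcases (show i = 17 ∨ 18 ≤ i by omega) with rfl | hi'
    · rw [ofList_append, hl, if_neg (by omega)]
      rfl
    · exact ofList_of_le (by omega)
  rw [← schubertValue_eq_of_monkEval (fun _ _ => schubertValue_of_leafValue) hlen hinj h]
  refine (schubertValue_stable (by norm_num) _ (fun i hi => ?_) hlast).symm
  -- injectivity keeps the first entries away from the fixed points
  by_contra hcon
  have := hinj (hlast _ (not_lt.1 hcon))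
  omega

/-- The principal specialization of a direct sum of `132` and of a permutation evaluated by
Monk's rule. -/
theorem upsilon_of_monkEval {w : Equiv.Perm (Fin 17)} {v : List ℕ} {z : ℤ}
    (hw : extend w⁻¹ = ofList (blockList 1 2 ++ (v ++ [17]))) (hv : v.length = 14)
    (hv' : ∀ a ∈ v ++ [17], 3 ≤ a) (hperm : (List.range 3 ++ v ++ [17]).Perm (List.range 18))
    (h : monkEval monkInversion leafValue 100 (List.range 3 ++ v ++ [17]) = some z) :
    (Upsilon w : ℚ) = 2 * z := by
  rw [upsilon_eq_schubertValue (by norm_num), hw,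
    schubertValue_append (n := 17) _ (by simp [blockList]) (by decide) hv']
  have e1 : (blockList 1 2).length = 3 := rfl
  rw [e1, schubertValue_eq_of_wordValue wordValue_blockWord_three, ← List.append_assoc,
    schubertValue_of_monkEval (by simp [hv]) hperm h]

theorem extend_eq_ofList {n : ℕ} {w : Equiv.Perm (Fin n)} {l : List ℕ}
    (h : ∀ i : Fin n, (w i : ℕ) = ofList l i) (h' : ∀ i, n ≤ i → ofList l i = i) :
    extend w = ofList l := by
  funext i
  by_cases hi : i < n
  · rw [extend, dif_pos hi, h]
  · rw [extend, dif_neg hi, h' i (by omega)]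

theorem upsilon_wStar : Upsilon wStar = 3272424600397137120000 := by
  have h := upsilon_of_monkEval (w := wStar)
    (v := [7, 5, 4, 3, 16, 15, 14, 13, 12, 11, 10, 9, 8, 6])
    (extend_eq_ofList (by decide) fun i hi => ?_) rfl (by decide) (by decide) monkEval_wStar_inv
  · refine Nat.cast_injective (R := ℚ) (h.trans ?_)
    norm_num
  · rcases (show i = 17 ∨ 18 ≤ i by omega) with rfl | hi'
    · rfl
    · exact ofList_of_le hi'

theorem upsilon_uStar : Upsilon uStar = 3528445515842977489500 := by
  have h := upsilon_of_monkEval (w := uStar)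
    (v := [7, 5, 4, 16, 3, 15, 14, 13, 12, 11, 10, 9, 8, 6])
    (extend_eq_ofList (by decide) fun i hi => ?_) rfl (by decide) (by decide) monkEval_uStar
  · refine Nat.cast_injective (R := ℚ) (h.trans ?_)
    norm_num
  · rcases (show i = 17 ∨ 18 ≤ i by omega) with rfl | hi'
    · rfl
    · exact ofList_of_le hi'

theorem wLayered_apply (i : Fin 17) :
    (wLayered i : ℕ) = ofList (layeredList 0 [1, 2, 4, 10]) i := by
  have h := congrFun (extend_layered_inv comp17) i
  rw [layered_inv, extend, dif_pos i.2] at h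
  exact h

theorem wStar_eq_mul : wStar = wLayered * Equiv.swap 6 7 := by
  ext i
  rw [Equiv.Perm.mul_apply, wLayered_apply]
  revert i
  decide

theorem uStar_eq_mul : uStar = wLayered * Equiv.swap 6 7 * Equiv.swap 3 16 := by
  ext i
  rw [Equiv.Perm.mul_apply, Equiv.Perm.mul_apply, wLayered_apply]
  revert i
  decide

theorem not_isLayered_of_lt {w : Equiv.Perm (Fin 17)} (h : 3050684475186219300000 < Upsilon w) :
    ¬ IsLayered w := by
  rintro ⟨c, rfl⟩
  exact absurd (upsilon_layered_le c) (by omega)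

end Schubert

/-- The Merzon–Smirnov conjecture fails, with the explicit counterexamples `w*` and `u*` in `S_17`.
`Equiv.swap 6 7` is `s_7`, and `Equiv.swap 3 16` transposes the positions `4` and `17`. -/
theorem mainTheorem1 :
    ¬ Schubert.MerzonSmirnovConjecture ∧
    -- the layered maximum in `S_17` is attained at `w(1, 2, 4, 10)`
    Schubert.Upsilon Schubert.wLayered = 3050684475186219300000 ∧
    (∀ v : Equiv.Perm (Fin 17), Schubert.IsLayered v →
      Schubert.Upsilon v ≤ Schubert.Upsilon Schubert.wLayered) ∧
    -- the permutation `w*`, about `7%` above the layered maximum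
    ¬ Schubert.IsLayered Schubert.wStar ∧
    Schubert.wStar = Schubert.wLayered * Equiv.swap 6 7 ∧
    Schubert.Upsilon Schubert.wStar = 3272424600397137120000 ∧
    (1.07 * (Schubert.Upsilon Schubert.wLayered : ℝ) < Schubert.Upsilon Schubert.wStar ∧
      (Schubert.Upsilon Schubert.wStar : ℝ) < 1.08 * Schubert.Upsilon Schubert.wLayered) ∧
    -- the permutation `u*`, about `15.6%` above the layered maximum
    ¬ Schubert.IsLayered Schubert.uStar ∧
    Schubert.uStar = Schubert.wLayered * Equiv.swap 6 7 * Equiv.swap 3 16 ∧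
    Schubert.Upsilon Schubert.uStar = 3528445515842977489500 ∧
    (1.156 * (Schubert.Upsilon Schubert.wLayered : ℝ) < Schubert.Upsilon Schubert.uStar ∧
      (Schubert.Upsilon Schubert.uStar : ℝ) < 1.157 * Schubert.Upsilon Schubert.wLayered) := by
  have hL := Schubert.upsilon_wLayered
  have hw := Schubert.upsilon_wStar
  have hu := Schubert.upsilon_uStar
  have hmax : ∀ v : Equiv.Perm (Fin 17), Schubert.IsLayered v →
      Schubert.Upsilon v ≤ Schubert.Upsilon Schubert.wLayered := by
    rintro v ⟨c, rfl⟩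
    rw [hL]
    exact Schubert.upsilon_layered_le c
  refine ⟨fun hMS => ?_, hL, hmax, Schubert.not_isLayered_of_lt (by rw [hw]; norm_num),
    Schubert.wStar_eq_mul, hw, ?_, Schubert.not_isLayered_of_lt (by rw [hu]; norm_num),
    Schubert.uStar_eq_mul, hu, ?_⟩
  · obtain ⟨w, hlay, hle⟩ := hMS 17
    have h1 := hle Schubert.wStar
    have h2 := hmax w hlay
    rw [hw] at h1
    rw [hL] at h2
    omega
  · rw [hL, hw]
    norm_num
  · rw [hL, hu]
    norm_num
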